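/- Let $\Gamma$ be a finitely generated (discrete) group and $\ell$ a prime number. Let $\Gamma^{(\ell)}$ be its pro-$\ell$ completion and $\widehat\Gamma$ its profinite completion, each with its inverse limit topology. A prounipotent group over a field $k$ of characteristic zero is an affine $k$-group that is an inverse limit of unipotent algebraic $k$-groups. The unipotent completion of $\Gamma$ over $\mathbb{Q}$ is a prounipotent $\mathbb{Q}$-group $\Gamma^{\mathrm{un}}_{/\mathbb{Q}}$ with a homomorphism $\theta:\Gamma\to\Gamma^{\mathrm{un}}_{/\mathbb{Q}}(\mathbb{Q})$ such that every homomorphism from $\Gamma$ to $U(\mathbb{Q})$, $U$ a unipotent $\mathbb{Q}$-group, factors uniquely through $\theta$, that is, is induced by a unique homomorphism $\Gamma^{\mathrm{un}}_{/\mathbb{Q}}\to U$ of $\mathbb{Q}$-groups. The $\ell$-adic unipotent completion of a profinite group $P$ is a prounipotent $\mathbb{Q}_\ell$-group $P^{\mathrm{un}}_{/\mathbb{Q}_\ell}$ with a continuous homomorphism $P\to P^{\mathrm{un}}_{/\mathbb{Q}_\ell}(\mathbb{Q}_\ell)$ such that every continuous homomorphism from $P$ to $U(\mathbb{Q}_\ell)$,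 $U$ a unipotent $\mathbb{Q}_\ell$-group, factors uniquely through it in the same sense; here $U(\mathbb{Q}_\ell)$ has the $\ell$-adic topology, and a homomorphism to the points of a prounipotent group is continuous if its composites with the projections to the unipotent algebraic quotients are continuous. Then the three completions $\Gamma^{\mathrm{un}}_{/\mathbb{Q}}$, $(\Gamma^{(\ell)})^{\mathrm{un}}_{/\mathbb{Q}_\ell}$ and $\widehat\Gamma^{\mathrm{un}}_{/\mathbb{Q}_\ell}$ exist, and the three groups $$\Gamma^{\mathrm{un}}_{/\mathbb{Q}}\otimes_{\mathbb{Q}}\mathbb{Q}_\ell,\qquad (\Gamma^{(\ell)})^{\mathrm{un}}_{/\mathbb{Q}_\ell},\qquad \widehat\Gamma^{\mathrm{un}}_{/\mathbb{Q}_\ell}$$ are canonically isomorphic as prounipotent $\mathbb{Q}_\ell$-groups: there is a unique isomorphism of $\mathbb{Q}_\ell$-groups between the first and the second, and a unique one between the first and the third, that is compatible with the canonical homomorphisms from $\Gamma$ to the groups of $\mathbb{Q}_\ell$-points, and there is a unique isomorphism between the third and the second that is compatible with the canonical homomorphism $\widehat\Gamma\to\Gamma^{(\ell)}$. -/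

import Mathlib

open scoped TensorProduct

universe u v w w'

noncomputable section

/-! ### Affine group schemes through their commutative Hopf algebras

An affine (proalgebraic) group `G` over a field `k` is given by its coordinate ring `A = 𝒪(G)`,
a commutative Hopf algebra over `k`; it is an algebraic group when `A` is a finitely generated
`k`-algebra. Homomorphisms `G_A → G_B` are the bialgebra homomorphisms `B →ₐc[k] A`
(they automatically commute with the antipodes). -/

/-- The group `G(k)` of `k`-rational points of the affine group `G` with coordinate ring `A`:
the `k`-algebra homomorphisms `A → k` under the convolution product. -/
abbrev RationalPoints (k : Type u) (A : Type v) [Field k] [CommRing A] [HopfAlgebra k A] :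
    Type (max u v) :=
  WithConv (A →ₐ[k] k)

/-- The algebraic `k`-group with coordinate ring `B` is unipotent: it has a faithful
(closed immersion) matrix representation `M` by upper triangular matrices with ones on the
diagonal, that is, it is isomorphic to a closed subgroup of some group `U_n` of such matrices. -/
def IsUnipotentGroup (k : Type u) (B : Type v) [Field k] [CommRing B] [HopfAlgebra k B] : Prop :=
  ∃ (n : ℕ) (M : Matrix (Fin n) (Fin n) B),
    (∀ i, M i i = 1) ∧
    (∀ i j, j < i → M i j = 0) ∧
    (∀ i j, Coalgebra.counit (R := k) (M i j) = if i = j then 1 else 0) ∧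
    (∀ i j, Coalgebra.comul (R := k) (M i j) = ∑ m, M i m ⊗ₜ[k] M m j) ∧
    Algebra.adjoin k {b : B | ∃ i j, M i j = b} = ⊤

/-- The affine `k`-group with coordinate ring `A` is prounipotent: it is the inverse limit of its
unipotent algebraic quotients, that is, `A` is the directed union of the coordinate rings
`B ⊆ A` (Hopf subalgebras) of unipotent algebraic groups. -/
def IsProunipotentGroup (k : Type u) (A : Type v) [Field k] [CommRing A] [HopfAlgebra k A] :
    Prop :=
  ∀ s : Finset A, ∃ (B : Type v) (_ : CommRing B) (_ : HopfAlgebra k B) (f : B →ₐc[k] A),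
    IsUnipotentGroup k B ∧ Function.Injective f ∧ (s : Set A) ⊆ Set.range f

/-- `θ : Γ → 𝒫(k)` exhibits the affine `k`-group `𝒫` with coordinate ring `A` as the unipotent
completion of the abstract group `Γ` over `k`: the group `𝒫` is prounipotent, and every
homomorphism `ρ` from `Γ` to the `k`-points of a unipotent `k`-group factors through `θ` by a
unique homomorphism of `k`-groups. -/
structure IsUnipotentCompletion {k : Type u} {Γ : Type w} {A : Type v} [Field k] [Group Γ]
    [CommRing A] [HopfAlgebra k A] (θ : Γ →* RationalPoints k A) : Prop where
  prounipotent : IsProunipotentGroup k A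
  existsUnique_lift : ∀ (B : Type u) [CommRing B] [HopfAlgebra k B], IsUnipotentGroup k B →
    ∀ ρ : Γ →* RationalPoints k B,
      ∃! f : B →ₐc[k] A, ∀ (γ : Γ) (b : B), (θ γ).ofConv (f b) = (ρ γ).ofConv b

/-- A homomorphism `ρ : Γ → G(k)` is continuous for the topology of `G(k)` induced from that
of `k`, the coarsest one for which every regular function `a ∈ 𝒪(G)` is continuous on `G(k)`. For
`G` an inverse limit this says that the homomorphisms to its algebraic quotients are continuous. -/
def IsContinuousRep {k : Type u} {Γ : Type w} {A : Type v} [Field k] [TopologicalSpace k]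
    [Group Γ] [TopologicalSpace Γ] [CommRing A] [HopfAlgebra k A]
    (ρ : Γ →* RationalPoints k A) : Prop :=
  ∀ a : A, Continuous fun γ : Γ => (ρ γ).ofConv a

/-- `θ : Γ → 𝒫(k)` exhibits the affine `k`-group `𝒫` with coordinate ring `A` as the continuous
unipotent completion of the topological group `Γ` over the topological field `k`. For `k = ℚ_ℓ`
this is the `ℓ`-adic unipotent completion. -/
structure IsContinuousUnipotentCompletion {k : Type u} {Γ : Type w} {A : Type v} [Field k]
    [TopologicalSpace k] [Group Γ] [TopologicalSpace Γ] [CommRing A] [HopfAlgebra k A]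
    (θ : Γ →* RationalPoints k A) : Prop where
  prounipotent : IsProunipotentGroup k A
  continuous : IsContinuousRep θ
  existsUnique_lift : ∀ (B : Type u) [CommRing B] [HopfAlgebra k B], IsUnipotentGroup k B →
    ∀ ρ : Γ →* RationalPoints k B, IsContinuousRep ρ →
      ∃! f : B →ₐc[k] A, ∀ (γ : Γ) (b : B), (θ γ).ofConv (f b) = (ρ γ).ofConv b

/-- The `K`-point of `G ⊗_k K` (with coordinate ring `K ⊗[k] A`) given by a `k`-point of `G`. -/
def extendPoint {k : Type u} (K : Type w) {A : Type v} [Field k] [Field K] [Algebra k K]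
    [CommRing A] [HopfAlgebra k A] (x : RationalPoints k A) : RationalPoints K (K ⊗[k] A) :=
  WithConv.toConv (Algebra.TensorProduct.lift (AlgHom.id K K)
    ((Algebra.ofId k K).comp x.ofConv) fun _ _ => Commute.all _ _)

/-! ### Profinite and pro-`ℓ` completions -/

/-- The normal subgroups of `Γ` whose index is a power of `ℓ`. -/
def PrimePowerIndexNormalSubgroup (ℓ : ℕ) (Γ : Type u) [Group Γ] : Type u :=
  {N : Subgroup Γ // N.Normal ∧ ∃ n : ℕ, N.index = ℓ ^ n}

instance (ℓ : ℕ) (Γ : Type u) [Group Γ] (N : PrimePowerIndexNormalSubgroup ℓ Γ) :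
    N.1.Normal := N.2.1

/-- The inverse limit of the quotients of `Γ` by its normal subgroups of `ℓ`-power index, as a
subgroup of their product. -/
def proLSubgroup (ℓ : ℕ) (Γ : Type u) [Group Γ] :
    Subgroup ((N : PrimePowerIndexNormalSubgroup ℓ Γ) → Γ ⧸ N.1) where
  carrier := {x | ∀ (M N : PrimePowerIndexNormalSubgroup ℓ Γ) (h : M.1 ≤ N.1),
    QuotientGroup.map M.1 N.1 (MonoidHom.id Γ) h (x M) = x N}
  one_mem' := fun _ _ _ => map_one _
  mul_mem' := fun {x y} hx hy M N h => by
    rw [Pi.mul_apply, Pi.mul_apply, map_mul, hx M N h, hy M N h]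
  inv_mem' := fun {x} hx M N h => by
    rw [Pi.inv_apply, Pi.inv_apply, map_inv, hx M N h]

/-- The pro-`ℓ` completion `Γ^(ℓ)` of the abstract group `Γ`. -/
def ProLCompletion (ℓ : ℕ) (Γ : Type u) [Group Γ] : Type u := proLSubgroup ℓ Γ

namespace ProLCompletion

variable (ℓ : ℕ) (Γ : Type u) [Group Γ]

instance : Group (ProLCompletion ℓ Γ) := inferInstanceAs (Group (proLSubgroup ℓ Γ))

/-- The inverse limit topology, each finite quotient being discrete. -/
instance : TopologicalSpace (ProLCompletion ℓ Γ) :=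
  ⨅ N : PrimePowerIndexNormalSubgroup ℓ Γ,
    TopologicalSpace.induced (fun x : ProLCompletion ℓ Γ => x.1 N) ⊥

/-- The canonical homomorphism `Γ → Γ^(ℓ)`. -/
def ofGroup : Γ →* ProLCompletion ℓ Γ where
  toFun γ := ⟨fun N => (γ : Γ ⧸ N.1), fun _ _ _ => rfl⟩
  map_one' := rfl
  map_mul' _ _ := rfl

end ProLCompletion

/-- The profinite completion of the abstract group `Γ`. -/
abbrev ProfiniteCompletion (Γ : Type u) [Group Γ] : ProfiniteGrp.{u} :=
  ProfiniteGrp.ProfiniteCompletion.completion (GrpCat.of Γ)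

/-- The canonical homomorphism from `Γ` to its profinite completion. -/
def toProfiniteCompletion (Γ : Type u) [Group Γ] : Γ →* ProfiniteCompletion Γ :=
  (ProfiniteGrp.ProfiniteCompletion.eta (GrpCat.of Γ)).hom

/-- A normal subgroup of prime power index, as a normal subgroup of finite index. -/
def PrimePowerIndexNormalSubgroup.toFiniteIndex {ℓ : ℕ} [Fact ℓ.Prime] {Γ : Type u} [Group Γ]
    (N : PrimePowerIndexNormalSubgroup ℓ Γ) : FiniteIndexNormalSubgroup (GrpCat.of Γ) where
  toSubgroup := N.1
  isNormal' := N.2.1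
  isFiniteIndex' := ⟨by
    obtain ⟨n, hn⟩ := N.2.2
    rw [hn]
    exact pow_ne_zero n (Fact.out : ℓ.Prime).ne_zero⟩

/-- The canonical homomorphism from the profinite to the pro-`ℓ` completion, which forgets the
components at the normal subgroups whose index is not a power of `ℓ`. -/
def profiniteToProL (ℓ : ℕ) [Fact ℓ.Prime] (Γ : Type u) [Group Γ] :
    ProfiniteCompletion Γ →* ProLCompletion ℓ Γ where
  toFun x := ⟨fun N => x.1 N.toFiniteIndex, fun M N h =>
    x.2 (show M.toFiniteIndex ⟶ N.toFiniteIndex from CategoryTheory.homOfLE h)⟩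
  map_one' := rfl
  map_mul' _ _ := rfl

end

noncomputable section

/-! ### Separation of tensor products by points -/

/-! A completion is recognised by the functions it induces on the group. For `θ : P → G(k)` with
Zariski dense image, `𝒪(G)` embeds into the functions `P → k`, and `G` with `θ` is determined up to
unique isomorphism by the image (`IsSeparating.existsUnique_bialgEquiv`). The continuous unipotent
completion is the case where the image consists of all polynomials in coefficients of continuous
unitriangular representations of `P`; this is packaged as `IsUnipotentHull`, and it is equivalent to
the universal property when `k` is a topological ring. Existence follows by making this algebra of
functions a Hopf algebra.

It then suffices to show that all three groups, with their maps from `Γ`, are hulls of the discrete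
group `Γ` over `ℚ_ℓ`. Finite generation enters through one degree count: in a product of
unitriangular matrices the `(i, j)` entry is a sum of products of at most `j - i` off-diagonal
entries of the factors, however long the word is.

For the base change, the count puts all entries in powers of a finite-dimensional `ℚ`-subspace `V`
of `ℚ_ℓ`. The representation therefore preserves a finite-dimensional `ℚ`-subspace of `ℚ_ℓ ^ n`, and
its coefficients are `ℚ_ℓ`-combinations of rational ones (`IsUnitriangularRep.mem_span_coeff`).

For the two completions, the count bounds denominators, so a representation over `ℚ_ℓ` is diagonally
conjugate to one over `ℤ_ℓ` (`IsUnitriangularRep.exists_integral`). Modulo `ℓ ^ a` its image lies in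
a finite `ℓ`-group. It is thus uniformly continuous for the pro-`ℓ` topology and extends to either
completion (`IsPrimePowerDense.exists_extension`). -/

theorem TensorProduct.eq_zero_of_forall_lTensor {k V W ι : Type*} [Field k] [AddCommGroup V]
    [Module k V] [AddCommGroup W] [Module k W] (μ : ι → W →ₗ[k] k)
    (hμ : ∀ w, (∀ i, μ i w = 0) → w = 0) (t : V ⊗[k] W)
    (ht : ∀ i, TensorProduct.rid k V ((μ i).lTensor V t) = 0) : t = 0 := by
  classical
  let b := Module.Basis.ofVectorSpace k V
  let e := TensorProduct.equivFinsuppOfBasisLeft (N := W) b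
  -- Write `t = ∑ b j ⊗ w j`. Contracting with `μ i` gives the vector with coordinates `μ i (w j)`,
  -- so every `w j` is killed by all `μ i`.
  have key : ∀ i j, ∀ t : V ⊗[k] W,
      μ i (e t j) = b.repr (TensorProduct.rid k V ((μ i).lTensor V t)) j := by
    intro i j t
    induction t with
    | zero => simp
    | add x y hx hy => simp [hx, hy]
    | tmul v w =>
      simp only [e, TensorProduct.equivFinsuppOfBasisLeft_apply_tmul_apply, map_smul,
        LinearMap.lTensor_tmul, TensorProduct.rid_tmul, Finsupp.smul_apply, smul_eq_mul]
      ring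
  have : e t = 0 := by
    ext j
    refine hμ _ fun i => ?_
    rw [key, ht]
    simp
  simpa using this

/-- The `k`-point of a product of affine schemes given by a pair of `k`-points. -/
abbrev pairPoint {k C D : Type*} [Field k] [CommRing C] [Algebra k C] [CommRing D] [Algebra k D]
    (x : C →ₐ[k] k) (y : D →ₐ[k] k) : C ⊗[k] D →ₐ[k] k :=
  Algebra.TensorProduct.lift x y fun _ _ => Commute.all _ _

theorem apply_rid_lTensor {k C D : Type*} [Field k] [CommRing C]
    [Algebra k C] [CommRing D] [Algebra k D] (x : C →ₐ[k] k) (y : D →ₐ[k] k) (t : C ⊗[k] D) :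
    x (TensorProduct.rid k C (y.toLinearMap.lTensor C t)) = pairPoint x y t := by
  induction t with
  | zero => simp
  | add a b ha hb => simp only [map_add, ha, hb]
  | tmul c d => simp [mul_comm]

theorem eq_zero_of_forall_pairPoint {k C D ι κ : Type*} [Field k] [CommRing C]
    [Algebra k C] [CommRing D] [Algebra k D] {x : ι → C →ₐ[k] k} {y : κ → D →ₐ[k] k}
    (hx : ∀ c, (∀ i, x i c = 0) → c = 0) (hy : ∀ d, (∀ j, y j d = 0) → d = 0) (t : C ⊗[k] D)
    (ht : ∀ i j, pairPoint (x i) (y j) t = 0) : t = 0 :=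
  TensorProduct.eq_zero_of_forall_lTensor (fun j => (y j).toLinearMap) hy t fun j =>
    hx _ fun i => by rw [apply_rid_lTensor, ht]

theorem eq_of_forall_pairPoint {k C D ι κ : Type*} [Field k] [CommRing C]
    [Algebra k C] [CommRing D] [Algebra k D] {x : ι → C →ₐ[k] k} {y : κ → D →ₐ[k] k}
    (hx : ∀ c, (∀ i, x i c = 0) → c = 0) (hy : ∀ d, (∀ j, y j d = 0) → d = 0) {s t : C ⊗[k] D}
    (ht : ∀ i j, pairPoint (x i) (y j) s = pairPoint (x i) (y j) t) : s = t :=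
  sub_eq_zero.1 <| eq_zero_of_forall_pairPoint hx hy _ fun i j => by rw [map_sub, ht, sub_self]

/-! ### Groups of rational points -/

section RationalPoints

variable {k : Type*} [Field k] {P : Type*} [Group P] {A : Type*} [CommRing A] [HopfAlgebra k A]
  {B : Type*} [CommRing B] [HopfAlgebra k B]

theorem RationalPoints.mul_apply (x y : RationalPoints k A) (a : A) :
    (x * y).ofConv a = pairPoint x.ofConv y.ofConv (Coalgebra.comul (R := k) a) :=
  AlgHom.convMul_apply x y a

theorem RationalPoints.one_apply (a : A) :
    (1 : RationalPoints k A).ofConv a = Coalgebra.counit (R := k) a := rfl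

/-- The image of `θ` is Zariski dense. -/
def IsSeparating (θ : P →* RationalPoints k A) : Prop :=
  ∀ a, (∀ x, (θ x).ofConv a = 0) → a = 0

theorem IsSeparating.eq {θ : P →* RationalPoints k A} (hθ : IsSeparating θ) {a b : A}
    (h : ∀ x, (θ x).ofConv a = (θ x).ofConv b) : a = b :=
  sub_eq_zero.1 <| hθ _ fun x => by rw [map_sub, h, sub_self]

theorem IsSeparating.eq_tmul {θ : P →* RationalPoints k A} (hθ : IsSeparating θ) {s t : A ⊗[k] A}
    (h : ∀ x y, pairPoint (θ x).ofConv (θ y).ofConv s = pairPoint (θ x).ofConv (θ y).ofConv t) :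
    s = t :=
  eq_of_forall_pairPoint (x := fun x => (θ x).ofConv) (y := fun x => (θ x).ofConv) hθ hθ h

/-- An algebra homomorphism that is compatible with homomorphisms of a group to the rational points
is a bialgebra homomorphism if the image in the points of its target is dense. -/
def IsSeparating.bialgHom {θ : P →* RationalPoints k A} (hθ : IsSeparating θ)
    (ρ : P →* RationalPoints k B) (f : B →ₐ[k] A)
    (hf : ∀ x b, (θ x).ofConv (f b) = (ρ x).ofConv b) : B →ₐc[k] A :=
  BialgHom.ofAlgHom f
    (by
      ext b
      have := hf 1 b
      rwa [map_one, map_one] at this)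
    (by
      ext b
      refine hθ.eq_tmul fun x y => ?_
      have h1 : (pairPoint (θ x).ofConv (θ y).ofConv).comp (Algebra.TensorProduct.map f f) =
          pairPoint (ρ x).ofConv (ρ y).ofConv := by
        ext b <;> simp [hf]
      have h2 := hf (x * y) b
      rw [map_mul, map_mul, RationalPoints.mul_apply, RationalPoints.mul_apply, ← h1] at h2
      exact h2.symm)

@[simp]
theorem IsSeparating.bialgHom_apply {θ : P →* RationalPoints k A} (hθ : IsSeparating θ)
    (ρ : P →* RationalPoints k B) (f : B →ₐ[k] A)
    (hf : ∀ x b, (θ x).ofConv (f b) = (ρ x).ofConv b) (b : B) : hθ.bialgHom ρ f hf b = f b := rfl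

/-- The homomorphism on rational points induced by a homomorphism of affine groups. -/
def RationalPoints.comap (f : B →ₐc[k] A) : RationalPoints k A →* RationalPoints k B where
  toFun x := WithConv.toConv (x.ofConv.comp (f : B →ₐ[k] A))
  map_one' := by
    apply WithConv.ofConv_injective
    ext b
    exact CoalgHomClass.counit_comp_apply f b
  map_mul' x y := by
    apply WithConv.ofConv_injective
    exact AlgHom.convMul_comp_bialgHom_distrib x y f

end RationalPoints

/-! ### Hopf algebras of functions on a group -/

section OfPoints

variable {k : Type*} [Field k] {P : Type*} [Group P] {S : Type*} [CommRing S] [Algebra k S]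
  {x : P → S →ₐ[k] k} (hx : ∀ f, (∀ p, x p f = 0) → f = 0) (δ : S →ₐ[k] S ⊗[k] S)
  (hδ : ∀ f p q, pairPoint (x p) (x q) (δ f) = x (p * q) f)

include hx hδ

/-- Points of `P` separate the tensor powers of `S`, so each Hopf algebra axiom can be tested at
tuples of points, where it becomes the corresponding group axiom of `P`. -/
theorem coassoc_of_points : (Algebra.TensorProduct.assoc k k k S S S).toAlgHom.comp
    ((Algebra.TensorProduct.map δ (.id k S)).comp δ) =
      (Algebra.TensorProduct.map (.id k S) δ).comp δ := by
  refine AlgHom.ext fun f => ?_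
  have hsep : ∀ t : S ⊗[k] S, (∀ p : P × P, pairPoint (x p.1) (x p.2) t = 0) → t = 0 :=
    fun t h => eq_zero_of_forall_pairPoint hx hx t fun p q => h (p, q)
  refine eq_of_forall_pairPoint hx hsep fun p q => ?_
  have h1 : (pairPoint (x p) (pairPoint (x q.1) (x q.2))).comp
      (Algebra.TensorProduct.assoc k k k S S S).toAlgHom =
      pairPoint (pairPoint (x p) (x q.1)) (x q.2) := by
    ext <;> simp [Algebra.TensorProduct.one_def]
  have h2 : (pairPoint (pairPoint (x p) (x q.1)) (x q.2)).comp
      (Algebra.TensorProduct.map δ (.id k S)) = pairPoint (x (p * q.1)) (x q.2) := by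
    ext f
    · simp [hδ]
    · simp
  have h3 : (pairPoint (x p) (pairPoint (x q.1) (x q.2))).comp
      (Algebra.TensorProduct.map (.id k S) δ) = pairPoint (x p) (x (q.1 * q.2)) := by
    ext f
    · simp
    · simp [hδ]
  have h4 := DFunLike.congr_fun h1 (Algebra.TensorProduct.map δ (.id k S) (δ f))
  have h5 := DFunLike.congr_fun h2 (δ f)
  have h6 := DFunLike.congr_fun h3 (δ f)
  rw [hδ] at h5 h6
  rw [mul_assoc] at h5
  exact (h4.trans h5).trans h6.symm

theorem map_counit_of_points : (Algebra.TensorProduct.map (x 1) (.id k S)).comp δ =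
    (Algebra.TensorProduct.lid k S).symm := by
  refine AlgHom.ext fun f => ?_
  refine eq_of_forall_pairPoint (x := fun _ : Unit => AlgHom.id k k) (fun c h => h ()) hx
    fun _ p => ?_
  have h1 : (pairPoint (AlgHom.id k k) (x p)).comp
      (Algebra.TensorProduct.map (x 1) (.id k S)) = pairPoint (x 1) (x p) := by
    ext <;> simp
  have h2 := DFunLike.congr_fun h1 (δ f)
  rw [hδ, one_mul] at h2
  exact h2.trans (by simp)

theorem map_comul_counit_of_points : (Algebra.TensorProduct.map (.id k S) (x 1)).comp δ =
    (Algebra.TensorProduct.rid k k S).symm := by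
  refine AlgHom.ext fun f => ?_
  refine eq_of_forall_pairPoint (y := fun _ : Unit => AlgHom.id k k) hx (fun c h => h ())
    fun p _ => ?_
  have h1 : (pairPoint (x p) (AlgHom.id k k)).comp
      (Algebra.TensorProduct.map (.id k S) (x 1)) = pairPoint (x p) (x 1) := by
    ext <;> simp
  have h2 := DFunLike.congr_fun h1 (δ f)
  rw [hδ, mul_one] at h2
  exact h2.trans (by simp)

theorem lift_antipode_id_of_points (σ : S →ₐ[k] S) (hσ : ∀ f p, x p (σ f) = x p⁻¹ f) (f : S) :
    Algebra.TensorProduct.lift σ (.id k S) (fun _ _ => Commute.all _ _) (δ f) =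
      algebraMap k S (x 1 f) := by
  refine sub_eq_zero.1 <| hx _ fun p => ?_
  rw [map_sub, sub_eq_zero, AlgHom.commutes]
  have h1 : (x p).comp (Algebra.TensorProduct.lift σ (.id k S) fun _ _ => Commute.all _ _) =
      pairPoint (x p⁻¹) (x p) := by
    ext f <;> simp [hσ]
  have h2 := DFunLike.congr_fun h1 (δ f)
  rwa [hδ, inv_mul_cancel] at h2

theorem lift_id_antipode_of_points (σ : S →ₐ[k] S) (hσ : ∀ f p, x p (σ f) = x p⁻¹ f) (f : S) :
    Algebra.TensorProduct.lift (.id k S) σ (fun _ _ => Commute.all _ _) (δ f) =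
      algebraMap k S (x 1 f) := by
  refine sub_eq_zero.1 <| hx _ fun p => ?_
  rw [map_sub, sub_eq_zero, AlgHom.commutes]
  have h1 : (x p).comp (Algebra.TensorProduct.lift (.id k S) σ fun _ _ => Commute.all _ _) =
      pairPoint (x p) (x p⁻¹) := by
    ext f <;> simp [hσ]
  have h2 := DFunLike.congr_fun h1 (δ f)
  rwa [hδ, mul_inv_cancel] at h2

/-- A comultiplication that is compatible with a separating group of points defines a bialgebra. -/
abbrev bialgebraOfPoints : Bialgebra k S :=
  Bialgebra.ofAlgHom δ (x 1) (coassoc_of_points hx δ hδ) (map_counit_of_points hx δ hδ)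
    (map_comul_counit_of_points hx δ hδ)

/-- A comultiplication and an antipode that are compatible with a separating group of points define
a Hopf algebra. -/
abbrev hopfAlgebraOfPoints (σ : S →ₐ[k] S) (hσ : ∀ f p, x p (σ f) = x p⁻¹ f) :
    HopfAlgebra k S :=
  letI := bialgebraOfPoints hx δ hδ
  HopfAlgebra.ofAlgHom σ (AlgHom.ext <| lift_antipode_id_of_points hx δ hδ σ hσ)
    (AlgHom.ext <| lift_id_antipode_of_points hx δ hδ σ hσ)

end OfPoints

section Functions

variable {k : Type*} [Field k] {P : Type*}

/-- Evaluation at a point of a group, on an algebra of functions on the group. -/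
def evalPoint (S : Subalgebra k (P → k)) (x : P) : S →ₐ[k] k :=
  (Pi.evalAlgHom k (fun _ => k) x).comp S.val

@[simp]
theorem evalPoint_apply (S : Subalgebra k (P → k)) (x : P) (f : S) : evalPoint S x f = f.1 x := rfl

theorem evalPoint_separating (S : Subalgebra k (P → k)) (f : S) (h : ∀ x, evalPoint S x f = 0) :
    f = 0 :=
  Subtype.ext (funext h)

theorem eq_of_evalPoint_tmul (S : Subalgebra k (P → k)) {s t : S ⊗[k] S}
    (h : ∀ x y, pairPoint (evalPoint S x) (evalPoint S y) s =
      pairPoint (evalPoint S x) (evalPoint S y) t) : s = t :=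
  eq_of_forall_pairPoint (evalPoint_separating S) (evalPoint_separating S) h

variable [Group P]

/-- The algebra `S` of functions on a group is stable under comultiplication and antipode. -/
class IsHopfFunctionAlgebra (S : Subalgebra k (P → k)) : Prop where
  exists_comul : ∀ f ∈ S, ∃ t : S ⊗[k] S, ∀ x y,
    pairPoint (evalPoint S x) (evalPoint S y) t = f (x * y)
  inv_mem : ∀ f ∈ S, (fun x => f x⁻¹) ∈ S

namespace IsHopfFunctionAlgebra

variable (S : Subalgebra k (P → k)) [hS : IsHopfFunctionAlgebra S]

/-- The comultiplication dual to the multiplication of the group. -/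
def comul : S →ₐ[k] S ⊗[k] S where
  -- The chosen tensor is determined by its values at pairs of points, so the choices respect the
  -- algebra operations.
  toFun f := (hS.exists_comul f.1 f.2).choose
  map_one' := eq_of_evalPoint_tmul S fun x y => by
    rw [(hS.exists_comul _ (1 : S).2).choose_spec, map_one]; rfl
  map_mul' f g := eq_of_evalPoint_tmul S fun x y => by
    rw [(hS.exists_comul _ (f * g).2).choose_spec, map_mul, (hS.exists_comul _ f.2).choose_spec,
      (hS.exists_comul _ g.2).choose_spec]; rfl
  map_zero' := eq_of_evalPoint_tmul S fun x y => by
    rw [(hS.exists_comul _ (0 : S).2).choose_spec, map_zero]; rfl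
  map_add' f g := eq_of_evalPoint_tmul S fun x y => by
    rw [(hS.exists_comul _ (f + g).2).choose_spec, map_add, (hS.exists_comul _ f.2).choose_spec,
      (hS.exists_comul _ g.2).choose_spec]; rfl
  commutes' c := eq_of_evalPoint_tmul S fun x y => by
    rw [(hS.exists_comul _ (algebraMap k S c).2).choose_spec, AlgHom.commutes]; rfl

theorem pairPoint_comul (f : S) (x y : P) :
    pairPoint (evalPoint S x) (evalPoint S y) (comul S f) = f.1 (x * y) :=
  (hS.exists_comul f.1 f.2).choose_spec x y

/-- The antipode dual to the inverse of the group. -/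
def antipode : S →ₐ[k] S where
  toFun f := ⟨fun x => f.1 x⁻¹, hS.inv_mem f.1 f.2⟩
  map_one' := rfl
  map_mul' _ _ := rfl
  map_zero' := rfl
  map_add' _ _ := rfl
  commutes' _ := rfl

instance bialgebra : Bialgebra k S :=
  bialgebraOfPoints (evalPoint_separating S) (comul S) (pairPoint_comul S)

instance hopfAlgebra : HopfAlgebra k S :=
  hopfAlgebraOfPoints (evalPoint_separating S) (comul S) (pairPoint_comul S) (antipode S)
    fun _ _ => rfl

theorem comul_eq (f : S) : Coalgebra.comul (R := k) f = comul S f := rfl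

theorem counit_eq (f : S) : Coalgebra.counit (R := k) f = f.1 1 := rfl

/-- The tautological homomorphism from a group to the points of a Hopf algebra of functions. -/
def points : P →* RationalPoints k S where
  toFun x := WithConv.toConv (evalPoint S x)
  map_one' := rfl
  map_mul' x y := by
    apply WithConv.ofConv_injective
    ext f
    exact (pairPoint_comul S f x y).symm.trans (RationalPoints.mul_apply _ _ f).symm

theorem isSeparating_points : IsSeparating (points S) := evalPoint_separating S

end IsHopfFunctionAlgebra

end Functions

/-! ### Transport of Hopf algebras to another universe -/

section Transport

variable {k A B : Type*} [Field k] [CommRing A] [Algebra k A] [CommRing B] [HopfAlgebra k B]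

namespace AlgEquiv

/-- Transport of the comultiplication along an isomorphism of algebras. -/
def transportComul (e : A ≃ₐ[k] B) : A →ₐ[k] A ⊗[k] A :=
  (Algebra.TensorProduct.map e.symm.toAlgHom e.symm.toAlgHom).comp
      ((Bialgebra.comulAlgHom k B).comp e.toAlgHom)

theorem transportComul_apply (e : A ≃ₐ[k] B) (a : A) : e.transportComul a =
    Algebra.TensorProduct.map e.symm.toAlgHom e.symm.toAlgHom (Coalgebra.comul (R := k) (e a)) :=
  rfl

theorem transport_coassoc (e : A ≃ₐ[k] B) : (Algebra.TensorProduct.assoc k k k A A A).toAlgHom.comp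
    ((Algebra.TensorProduct.map e.transportComul (.id k A)).comp e.transportComul) =
      (Algebra.TensorProduct.map (.id k A) e.transportComul).comp e.transportComul := by
  refine AlgHom.ext fun a => ?_
  let E := Algebra.TensorProduct.map e.symm.toAlgHom
    (Algebra.TensorProduct.map e.symm.toAlgHom e.symm.toAlgHom)
  have h1 : ((Algebra.TensorProduct.assoc k k k A A A).toAlgHom.comp
      (Algebra.TensorProduct.map e.transportComul (.id k A))).comp
      (Algebra.TensorProduct.map e.symm.toAlgHom e.symm.toAlgHom) =
      E.comp ((Algebra.TensorProduct.assoc k k k B B B).toAlgHom.comp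
        (Algebra.TensorProduct.map (Bialgebra.comulAlgHom k B) (.id k B))) := by
    have h0 : (Algebra.TensorProduct.assoc k k k A A A).toAlgHom.comp
        (Algebra.TensorProduct.map
          (Algebra.TensorProduct.map e.symm.toAlgHom e.symm.toAlgHom) e.symm.toAlgHom) =
        E.comp (Algebra.TensorProduct.assoc k k k B B B).toAlgHom := by
      ext <;> simp [E, Algebra.TensorProduct.one_def]
    rw [← AlgHom.comp_assoc, ← h0]
    ext b
    · simp [transportComul_apply]
    · simp
  have h2 : (Algebra.TensorProduct.map (.id k A) e.transportComul).comp
      (Algebra.TensorProduct.map e.symm.toAlgHom e.symm.toAlgHom) =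
      E.comp (Algebra.TensorProduct.map (.id k B) (Bialgebra.comulAlgHom k B)) := by
    ext b
    · simp [E]
    · simp [E, transportComul_apply]
  have h3 := DFunLike.congr_fun h1 (Coalgebra.comul (R := k) (e a))
  have h4 := DFunLike.congr_fun h2 (Coalgebra.comul (R := k) (e a))
  exact h3.trans <| (congrArg E (Coalgebra.coassoc_apply (e a))).trans h4.symm

theorem transport_counit_comul (e : A ≃ₐ[k] B) :
    (Algebra.TensorProduct.map ((Bialgebra.counitAlgHom k B).comp e.toAlgHom) (.id k A)).comp
      e.transportComul = (Algebra.TensorProduct.lid k A).symm := by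
  refine AlgHom.ext fun a => ?_
  have h1 : (Algebra.TensorProduct.map ((Bialgebra.counitAlgHom k B).comp e.toAlgHom)
      (.id k A)).comp (Algebra.TensorProduct.map e.symm.toAlgHom e.symm.toAlgHom) =
      (Algebra.TensorProduct.map (.id k k) e.symm.toAlgHom).comp
        (Algebra.TensorProduct.map (Bialgebra.counitAlgHom k B) (.id k B)) := by
    ext <;> simp
  refine (DFunLike.congr_fun h1 (Coalgebra.comul (R := k) (e a))).trans ?_
  refine (congrArg (Algebra.TensorProduct.map (.id k k) e.symm.toAlgHom)
    (Coalgebra.rTensor_counit_comul (e a))).trans ?_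
  simp

theorem transport_comul_counit (e : A ≃ₐ[k] B) :
    (Algebra.TensorProduct.map (.id k A) ((Bialgebra.counitAlgHom k B).comp e.toAlgHom)).comp
      e.transportComul = (Algebra.TensorProduct.rid k k A).symm := by
  refine AlgHom.ext fun a => ?_
  have h1 : (Algebra.TensorProduct.map (.id k A) ((Bialgebra.counitAlgHom k B).comp e.toAlgHom)
      ).comp (Algebra.TensorProduct.map e.symm.toAlgHom e.symm.toAlgHom) =
      (Algebra.TensorProduct.map e.symm.toAlgHom (.id k k)).comp
        (Algebra.TensorProduct.map (.id k B) (Bialgebra.counitAlgHom k B)) := by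
    ext <;> simp
  refine (DFunLike.congr_fun h1 (Coalgebra.comul (R := k) (e a))).trans ?_
  refine (congrArg (Algebra.TensorProduct.map e.symm.toAlgHom (.id k k))
    (Coalgebra.lTensor_counit_comul (e a))).trans ?_
  simp

theorem transport_antipode_left (e : A ≃ₐ[k] B) (a : A) :
    Algebra.TensorProduct.lift
      (e.symm.toAlgHom.comp ((HopfAlgebra.antipodeAlgHom k B).comp e.toAlgHom)) (.id k A)
      (fun _ _ => Commute.all _ _) (e.transportComul a) =
    algebraMap k A (Coalgebra.counit (R := k) (e a)) := by
  have h : ∀ t : B ⊗[k] B, Algebra.TensorProduct.lift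
      (e.symm.toAlgHom.comp ((HopfAlgebra.antipodeAlgHom k B).comp e.toAlgHom)) (.id k A)
      (fun _ _ => Commute.all _ _)
      (Algebra.TensorProduct.map e.symm.toAlgHom e.symm.toAlgHom t) =
      e.symm (LinearMap.mul' k B ((HopfAlgebra.antipode k).rTensor B t)) := by
    intro t
    induction t with
    | zero => simp
    | add a b ha hb => simp only [map_add, ha, hb]
    | tmul a b => simp
  rw [transportComul_apply, h, HopfAlgebra.mul_antipode_rTensor_comul_apply, AlgEquiv.commutes]

theorem transport_antipode_right (e : A ≃ₐ[k] B) (a : A) :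
    Algebra.TensorProduct.lift (.id k A)
      (e.symm.toAlgHom.comp ((HopfAlgebra.antipodeAlgHom k B).comp e.toAlgHom))
      (fun _ _ => Commute.all _ _) (e.transportComul a) =
    algebraMap k A (Coalgebra.counit (R := k) (e a)) := by
  have h : ∀ t : B ⊗[k] B, Algebra.TensorProduct.lift (.id k A)
      (e.symm.toAlgHom.comp ((HopfAlgebra.antipodeAlgHom k B).comp e.toAlgHom))
      (fun _ _ => Commute.all _ _)
      (Algebra.TensorProduct.map e.symm.toAlgHom e.symm.toAlgHom t) =
      e.symm (LinearMap.mul' k B ((HopfAlgebra.antipode k).lTensor B t)) := by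
    intro t
    induction t with
    | zero => simp
    | add a b ha hb => simp only [map_add, ha, hb]
    | tmul a b => simp
  rw [transportComul_apply, h, HopfAlgebra.mul_antipode_lTensor_comul_apply, AlgEquiv.commutes]

/-- Transport of a bialgebra structure along an isomorphism of algebras. -/
abbrev transportBialgebra (e : A ≃ₐ[k] B) : Bialgebra k A :=
  Bialgebra.ofAlgHom e.transportComul ((Bialgebra.counitAlgHom k B).comp e.toAlgHom)
    e.transport_coassoc e.transport_counit_comul e.transport_comul_counit

/-- Transport of a Hopf algebra structure along an isomorphism of algebras. -/
abbrev transportHopfAlgebra (e : A ≃ₐ[k] B) : HopfAlgebra k A :=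
  letI := e.transportBialgebra
  HopfAlgebra.ofAlgHom (e.symm.toAlgHom.comp ((HopfAlgebra.antipodeAlgHom k B).comp e.toAlgHom))
    (AlgHom.ext e.transport_antipode_left) (AlgHom.ext e.transport_antipode_right)

/-- The isomorphism of bialgebras underlying the transport of a Hopf algebra structure. -/
def transportBialgEquiv (e : A ≃ₐ[k] B) :
    letI := e.transportHopfAlgebra
    A ≃ₐc[k] B :=
  letI := e.transportHopfAlgebra
  BialgEquiv.ofAlgEquiv e rfl <| by
    have h1 : (Algebra.TensorProduct.map e.toAlgHom e.toAlgHom).comp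
        (Algebra.TensorProduct.map e.symm.toAlgHom e.symm.toAlgHom) = .id k _ := by
      ext <;> simp
    exact AlgHom.ext fun a => DFunLike.congr_fun h1 (Coalgebra.comul (R := k) (e a))

end AlgEquiv

/-- A Hopf algebra that is a small type is isomorphic to one in the smaller universe. -/
theorem exists_bialgEquiv_of_small {k : Type u} {B : Type v} [Field k] [CommRing B]
    [HopfAlgebra k B] [Small.{w} B] :
    ∃ (A : Type w) (_ : CommRing A) (_ : HopfAlgebra k A), Nonempty (A ≃ₐc[k] B) :=
  ⟨Shrink.{w} B, inferInstance, (Shrink.algEquiv k B).transportHopfAlgebra,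
    ⟨(Shrink.algEquiv k B).transportBialgEquiv⟩⟩

end Transport

/-! ### Unitriangular representations and their coefficients -/

section Coefficients

variable {k : Type*} [Field k] {P : Type*} [Group P] {n : ℕ}

/-- A matrix representation by upper triangular matrices with ones on the diagonal. -/
def IsUnitriangularRep (m : P →* Matrix (Fin n) (Fin n) k) : Prop :=
  ∀ x, (∀ i, m x i i = 1) ∧ ∀ i j, j < i → m x i j = 0

/-- The algebra of functions generated by the coefficients of a matrix representation. -/
def coeffAlgebra (m : P →* Matrix (Fin n) (Fin n) k) : Subalgebra k (P → k) :=
  Algebra.adjoin k {f | ∃ i j, (fun x => m x i j) = f}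

theorem coeff_mem_coeffAlgebra (m : P →* Matrix (Fin n) (Fin n) k) (i j : Fin n) :
    (fun x => m x i j) ∈ coeffAlgebra m :=
  Algebra.subset_adjoin ⟨i, j, rfl⟩

/-- The matrix of coefficients of a representation. -/
def coeffMatrix (m : P →* Matrix (Fin n) (Fin n) k) : Matrix (Fin n) (Fin n) (coeffAlgebra m) :=
  Matrix.of fun i j => ⟨fun x => m x i j, coeff_mem_coeffAlgebra m i j⟩

theorem coeffMatrix_apply (m : P →* Matrix (Fin n) (Fin n) k) (i j : Fin n) (x : P) :
    (coeffMatrix m i j).1 x = m x i j := rfl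

/-- The determinant is `1`, so entries of the inverse are polynomials in the entries. This keeps the
coefficient algebra stable under the antipode without inverting anything. -/
theorem IsUnitriangularRep.apply_inv {m : P →* Matrix (Fin n) (Fin n) k}
    (hm : IsUnitriangularRep m) (x : P) : m x⁻¹ = (m x).adjugate := by
  have hdet : (m x).det = 1 := by
    rw [Matrix.det_of_isUpperTriangular fun i j h => (hm x).2 i j h]
    exact Finset.prod_eq_one fun i _ => (hm x).1 i
  have h1 : m x⁻¹ * m x = 1 := by rw [← map_mul, inv_mul_cancel, map_one]
  calc m x⁻¹ = m x⁻¹ * (m x * (m x).adjugate) := by rw [Matrix.mul_adjugate, hdet]; simp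
    _ = _ := by rw [← mul_assoc, h1, one_mul]

theorem exists_comul_coeffAlgebra (m : P →* Matrix (Fin n) (Fin n) k) (f : P → k)
    (hf : f ∈ coeffAlgebra m) : ∃ t : coeffAlgebra m ⊗[k] coeffAlgebra m, ∀ x y,
      pairPoint (evalPoint _ x) (evalPoint _ y) t = f (x * y) := by
  induction hf using Algebra.adjoin_induction with
  | mem f hf =>
    obtain ⟨i, j, rfl⟩ := hf
    refine ⟨∑ l, coeffMatrix m i l ⊗ₜ coeffMatrix m l j, fun x y => ?_⟩
    simp [coeffMatrix_apply, Matrix.mul_apply]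
  | algebraMap c => exact ⟨algebraMap k _ c, fun x y => AlgHom.commutes _ _⟩
  | add f g _ _ hf hg =>
    obtain ⟨s, hs⟩ := hf
    obtain ⟨t, ht⟩ := hg
    exact ⟨s + t, fun x y => by rw [map_add, hs, ht]; rfl⟩
  | mul f g _ _ hf hg =>
    obtain ⟨s, hs⟩ := hf
    obtain ⟨t, ht⟩ := hg
    exact ⟨s * t, fun x y => by rw [map_mul, hs, ht]; rfl⟩

theorem IsUnitriangularRep.inv_mem_coeffAlgebra {m : P →* Matrix (Fin n) (Fin n) k}
    (hm : IsUnitriangularRep m) (f : P → k) (hf : f ∈ coeffAlgebra m) :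
    (fun x => f x⁻¹) ∈ coeffAlgebra m := by
  induction hf using Algebra.adjoin_induction with
  | mem f hf =>
    obtain ⟨i, j, rfl⟩ := hf
    convert ((coeffMatrix m).adjugate i j).2 using 1
    funext x
    have h : (evalPoint (coeffAlgebra m) x).toRingHom.mapMatrix (coeffMatrix m) = m x := rfl
    have h1 := congrFun (congrFun
      ((evalPoint (coeffAlgebra m) x).toRingHom.map_adjugate (coeffMatrix m)) i) j
    rw [h, ← hm.apply_inv] at h1
    exact h1.symm
  | algebraMap c => exact (coeffAlgebra m).algebraMap_mem c
  | add f g _ _ hf hg => exact add_mem hf hg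
  | mul f g _ _ hf hg => exact mul_mem hf hg

theorem IsUnitriangularRep.isHopfFunctionAlgebra {m : P →* Matrix (Fin n) (Fin n) k}
    (hm : IsUnitriangularRep m) : IsHopfFunctionAlgebra (coeffAlgebra m) where
  exists_comul := exists_comul_coeffAlgebra m
  inv_mem := hm.inv_mem_coeffAlgebra

theorem IsUnitriangularRep.isUnipotentGroup {m : P →* Matrix (Fin n) (Fin n) k}
    (hm : IsUnitriangularRep m) [IsHopfFunctionAlgebra (coeffAlgebra m)] :
    IsUnipotentGroup k (coeffAlgebra m) := by
  refine ⟨n, coeffMatrix m, fun i => ?_, fun i j h => ?_, fun i j => ?_, fun i j => ?_, ?_⟩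
  · exact Subtype.ext (funext fun x => (hm x).1 i)
  · exact Subtype.ext (funext fun x => (hm x).2 i j h)
  · rw [IsHopfFunctionAlgebra.counit_eq, coeffMatrix_apply, map_one, Matrix.one_apply]
  · refine eq_of_evalPoint_tmul _ fun x y => ?_
    rw [IsHopfFunctionAlgebra.comul_eq, IsHopfFunctionAlgebra.pairPoint_comul]
    simp [coeffMatrix_apply, Matrix.mul_apply]
  · refine (congrArg (Algebra.adjoin k) ?_).trans (Algebra.adjoin_adjoin_coe_preimage (R := k)
      (s := {f | ∃ i j, (fun x => m x i j) = f}))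
    ext b
    simp only [Subtype.ext_iff, coeffMatrix]
    rfl

/-- A representation over an index set with a degree function, triangular with respect to it, is
unitriangular after a suitable numbering of the index set. -/
theorem exists_isUnitriangularRep {ι : Type*} [Fintype ι] [DecidableEq ι] (d : ι → ℕ)
    (m : P →* Matrix ι ι k) (hdiag : ∀ x i, m x i i = 1)
    (hzero : ∀ x i j, i ≠ j → d j ≤ d i → m x i j = 0) :
    ∃ (n : ℕ) (m' : P →* Matrix (Fin n) (Fin n) k) (e : Fin n ≃ ι),
      IsUnitriangularRep m' ∧ ∀ x a b, m' x a b = m x (e a) (e b) := by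
  let e₀ := (Fintype.equivFin ι).symm
  -- Number the indices by increasing degree. Ties may be broken arbitrarily, since `hzero` also
  -- kills off-diagonal entries between indices of equal degree.
  let e := (Tuple.sort (d ∘ e₀)).trans e₀
  have he : Monotone (d ∘ e) := Tuple.monotone_sort (d ∘ e₀)
  refine ⟨_, ((Matrix.reindexAlgEquiv k k e.symm : _ →* _)).comp m, e,
    fun x => ⟨fun i => hdiag x (e i), fun i j h => hzero x _ _ ?_ (he h.le)⟩, fun x a b => rfl⟩
  exact fun h' => h.ne' (e.injective h')

end Coefficients

/-! ### Evaluation of regular functions along a homomorphism to rational points -/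

section EvalHom

variable {k : Type*} [Field k] {P : Type*} [Group P] {A : Type*} [CommRing A] [HopfAlgebra k A]
  {B : Type*} [CommRing B] [HopfAlgebra k B]

/-- Restriction of regular functions along `θ : P → G(k)`. -/
def evalHom (θ : P →* RationalPoints k A) : A →ₐ[k] (P → k) :=
  AlgHom.pi fun x => (θ x).ofConv

theorem IsSeparating.evalHom_injective {θ : P →* RationalPoints k A} (hθ : IsSeparating θ) :
    Function.Injective (evalHom θ) :=
  fun _ _ h => hθ.eq fun x => congrFun h x

theorem IsSeparating.bialgHom_ext {θ : P →* RationalPoints k A} (hθ : IsSeparating θ)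
    {F X : Type*} [FunLike F X A] {f g : F}
    (h : ∀ x b, (θ x).ofConv (f b) = (θ x).ofConv (g b)) : f = g :=
  DFunLike.ext _ _ fun b => hθ.eq fun x => h x b

/-- Density makes `evalHom θ` injective, so the only candidate is `evalHom ρ` followed by its
inverse on the range. Compatibility with comultiplication is again checked on points. -/
theorem IsSeparating.existsUnique_bialgHom {θ : P →* RationalPoints k A} (hθ : IsSeparating θ)
    (ρ : P →* RationalPoints k B) (h : (evalHom ρ).range ≤ (evalHom θ).range) :
    ∃! f : B →ₐc[k] A, ∀ x b, (θ x).ofConv (f b) = (ρ x).ofConv b := by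
  let e := AlgEquiv.ofInjective (evalHom θ) hθ.evalHom_injective
  let f : B →ₐ[k] A := e.symm.toAlgHom.comp
    ((Subalgebra.inclusion h).comp (evalHom ρ).rangeRestrict)
  have hf : ∀ x b, (θ x).ofConv (f b) = (ρ x).ofConv b := fun x b =>
    congrFun (congrArg Subtype.val
      (e.apply_symm_apply ((Subalgebra.inclusion h) ((evalHom ρ).rangeRestrict b)))) x
  exact ⟨hθ.bialgHom ρ f hf, hf, fun g hg => hθ.bialgHom_ext fun x b => by
    rw [hg, hθ.bialgHom_apply, hf]⟩

theorem IsSeparating.existsUnique_bialgEquiv {θ : P →* RationalPoints k A} (hθ : IsSeparating θ)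
    {ρ : P →* RationalPoints k B} (hρ : IsSeparating ρ)
    (h : (evalHom ρ).range = (evalHom θ).range) :
    ∃! φ : B ≃ₐc[k] A, ∀ x b, (θ x).ofConv (φ b) = (ρ x).ofConv b := by
  obtain ⟨f, hf, -⟩ := hθ.existsUnique_bialgHom ρ h.le
  obtain ⟨g, hg, -⟩ := hρ.existsUnique_bialgHom θ h.ge
  refine ⟨BialgEquiv.ofBialgHom f g ?_ ?_, hf, fun φ hφ => hθ.bialgHom_ext fun x b => ?_⟩
  · exact hθ.bialgHom_ext fun x b => (hf x (g b)).trans (hg x b)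
  · exact hρ.bialgHom_ext fun x b => (hg x (f b)).trans (hf x b)
  · exact (hφ x b).trans (hf x b).symm

/-- The matrix representation of `P` given by a homomorphism to the points of a group and a
multiplicative matrix of regular functions. -/
def repOfPoints (ρ : P →* RationalPoints k B) {n : ℕ} (M : Matrix (Fin n) (Fin n) B)
    (hε : ∀ i j, Coalgebra.counit (R := k) (M i j) = if i = j then 1 else 0)
    (hδ : ∀ i j, Coalgebra.comul (R := k) (M i j) = ∑ m, M i m ⊗ₜ[k] M m j) :
    P →* Matrix (Fin n) (Fin n) k where
  toFun x := M.map (ρ x).ofConv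
  map_one' := by
    ext i j
    rw [map_one, Matrix.map_apply, RationalPoints.one_apply, hε, Matrix.one_apply]
  map_mul' x y := by
    ext i j
    rw [map_mul, Matrix.map_apply, RationalPoints.mul_apply, hδ, Matrix.mul_apply]
    simp

/-- Homomorphisms to the points of a unipotent group are unitriangular representations. -/
theorem IsUnipotentGroup.exists_rep (hB : IsUnipotentGroup k B) (ρ : P →* RationalPoints k B) :
    ∃ (n : ℕ) (M : Matrix (Fin n) (Fin n) B) (m : P →* Matrix (Fin n) (Fin n) k),
      IsUnitriangularRep m ∧ (∀ x i j, m x i j = (ρ x).ofConv (M i j)) ∧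
      (evalHom ρ).range = coeffAlgebra m := by
  obtain ⟨n, M, h1, h0, hε, hδ, htop⟩ := hB
  refine ⟨n, M, repOfPoints ρ M hε hδ, fun x => ⟨fun i => ?_, fun i j h => ?_⟩,
    fun x i j => rfl, ?_⟩
  · exact (congrArg (ρ x).ofConv (h1 i)).trans (map_one _)
  · exact (congrArg (ρ x).ofConv (h0 i j h)).trans (map_zero _)
  · rw [← Algebra.map_top, ← htop, AlgHom.map_adjoin, coeffAlgebra]
    congr 1
    ext f
    constructor
    · rintro ⟨_, ⟨i, j, rfl⟩, rfl⟩
      exact ⟨i, j, rfl⟩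
    · rintro ⟨i, j, rfl⟩
      exact ⟨_, ⟨i, j, rfl⟩, rfl⟩

end EvalHom

/-! ### Independence of the universe -/

section Universe

theorem IsUnipotentGroup.of_bialgEquiv {k A B : Type*} [Field k] [CommRing A] [HopfAlgebra k A]
    [CommRing B] [HopfAlgebra k B] (hB : IsUnipotentGroup k B) (e : B ≃ₐc[k] A) :
    IsUnipotentGroup k A := by
  obtain ⟨n, M, h1, h0, hε, hδ, htop⟩ := hB
  refine ⟨n, M.map e, fun i => ?_, fun i j h => ?_, fun i j => ?_, fun i j => ?_, ?_⟩
  · rw [Matrix.map_apply, h1, map_one]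
  · rw [Matrix.map_apply, h0 i j h, map_zero]
  · rw [Matrix.map_apply, CoalgHomClass.counit_comp_apply, hε]
  · rw [Matrix.map_apply, ← CoalgHomClass.map_comp_comul_apply, hδ]
    simp
  · have h := congrArg (Subalgebra.map (e : B →ₐ[k] A)) htop
    rw [AlgHom.map_adjoin, Algebra.map_top, (AlgHom.range_eq_top _).2 e.surjective] at h
    rw [← h]
    congr 1
    ext f
    constructor
    · rintro ⟨i, j, rfl⟩
      exact ⟨_, ⟨i, j, rfl⟩, rfl⟩
    · rintro ⟨_, ⟨i, j, rfl⟩, rfl⟩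
      exact ⟨i, j, rfl⟩

/-- The coordinate ring is a quotient of a polynomial ring in finitely many variables over `k`. The
universal property only tests groups in the universe of `k`, whereas Hopf subalgebras of `A` live in
the universe of `A`; smallness bridges the two. -/
theorem IsUnipotentGroup.small {k : Type u} {B : Type v} [Field k] [CommRing B] [HopfAlgebra k B]
    (hB : IsUnipotentGroup k B) : Small.{u} B := by
  obtain ⟨n, M, -, -, -, -, htop⟩ := hB
  have : (MvPolynomial.aeval (R := k) fun p : Fin n × Fin n => M p.1 p.2).range = ⊤ := by
    rw [← Algebra.adjoin_range_eq_range_aeval, ← htop]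
    congr 1
    ext f
    simp
  exact small_of_surjective ((AlgHom.range_eq_top _).1 this)

theorem IsUnipotentGroup.exists_bialgEquiv {k : Type u} {B : Type v} [Field k] [CommRing B]
    [HopfAlgebra k B] (hB : IsUnipotentGroup k B) :
    ∃ (A : Type u) (_ : CommRing A) (_ : HopfAlgebra k A), IsUnipotentGroup k A ∧
      Nonempty (A ≃ₐc[k] B) := by
  have := hB.small
  obtain ⟨A, _, _, ⟨e⟩⟩ := exists_bialgEquiv_of_small.{u, v, u} (k := k) (B := B)
  exact ⟨A, _, _, hB.of_bialgEquiv e.symm, ⟨e⟩⟩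

end Universe

/-! ### A criterion for unipotent completions -/

section Hull

variable {k : Type u} [Field k] [TopologicalSpace k] {P : Type w} [Group P] [TopologicalSpace P]
  {A : Type v} [CommRing A] [HopfAlgebra k A]

/-- `θ` has dense image in a prounipotent group, the regular functions on which restrict to
continuous functions on `P` that include all coefficients of continuous unitriangular
representations. -/
structure IsUnipotentHull (θ : P →* RationalPoints k A) : Prop where
  prounipotent : IsProunipotentGroup k A
  continuous : IsContinuousRep θ
  separating : IsSeparating θ
  coeff_mem : ∀ (n : ℕ) (m : P →* Matrix (Fin n) (Fin n) k), IsUnitriangularRep m →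
    (∀ i j, Continuous fun x => m x i j) → ∀ i j, (fun x => m x i j) ∈ (evalHom θ).range

theorem IsUnipotentHull.range_le {θ : P →* RationalPoints k A} (hθ : IsUnipotentHull θ)
    {B : Type*} [CommRing B] [HopfAlgebra k B] (hB : IsUnipotentGroup k B)
    (ρ : P →* RationalPoints k B) (hρ : IsContinuousRep ρ) :
    (evalHom ρ).range ≤ (evalHom θ).range := by
  obtain ⟨n, M, m, hm, hmM, h⟩ := hB.exists_rep ρ
  rw [h]
  refine Algebra.adjoin_le ?_
  rintro _ ⟨i, j, rfl⟩
  refine hθ.coeff_mem n m hm (fun i j => ?_) i j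
  simp only [hmM]
  exact hρ (M i j)

theorem IsUnipotentHull.isContinuousUnipotentCompletion {θ : P →* RationalPoints k A}
    (hθ : IsUnipotentHull θ) : IsContinuousUnipotentCompletion θ where
  prounipotent := hθ.prounipotent
  continuous := hθ.continuous
  existsUnique_lift _ _ _ hB ρ hρ := hθ.separating.existsUnique_bialgHom ρ (hθ.range_le hB ρ hρ)

theorem IsContinuousUnipotentCompletion.existsUnique_lift' {θ : P →* RationalPoints k A}
    (hθ : IsContinuousUnipotentCompletion θ) {B : Type w'} [CommRing B] [HopfAlgebra k B]
    (hB : IsUnipotentGroup k B) (ρ : P →* RationalPoints k B) (hρ : IsContinuousRep ρ) :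
    ∃! f : B →ₐc[k] A, ∀ x b, (θ x).ofConv (f b) = (ρ x).ofConv b := by
  obtain ⟨B', _, _, hB', ⟨e⟩⟩ := hB.exists_bialgEquiv
  obtain ⟨f, hf, huniq⟩ := hθ.existsUnique_lift B' hB'
    ((RationalPoints.comap (e : B' →ₐc[k] B)).comp ρ) fun b => hρ (e b)
  refine ⟨f.comp (e.symm : B →ₐc[k] B'), fun x b => ?_, fun g hg => ?_⟩
  · refine (hf x (e.symm b)).trans ?_
    change (ρ x).ofConv (e (e.symm b)) = _
    rw [e.apply_symm_apply]
  · have := huniq (g.comp (e : B' →ₐc[k] B)) fun x b => hg x (e b)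
    rw [← this]
    ext b
    change g b = g (e (e.symm b))
    rw [e.apply_symm_apply]

theorem continuous_of_mem_coeffAlgebra [IsTopologicalRing k] {n : ℕ}
    {m : P →* Matrix (Fin n) (Fin n) k} (hm : ∀ i j, Continuous fun x => m x i j) {f : P → k}
    (hf : f ∈ coeffAlgebra m) : Continuous f := by
  induction hf using Algebra.adjoin_induction with
  | mem f hf =>
    obtain ⟨i, j, rfl⟩ := hf
    exact hm i j
  | algebraMap c => exact continuous_const
  | add f g _ _ hf hg => exact hf.add hg
  | mul f g _ _ hf hg => exact hf.mul hg

theorem IsContinuousUnipotentCompletion.exists_lift_coeffAlgebra [IsTopologicalRing k]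
    {θ : P →* RationalPoints k A} (hθ : IsContinuousUnipotentCompletion θ) {n : ℕ}
    {m : P →* Matrix (Fin n) (Fin n) k} (hm : IsUnitriangularRep m)
    [IsHopfFunctionAlgebra (coeffAlgebra m)] (hc : ∀ i j, Continuous fun x => m x i j) :
    ∃ f : coeffAlgebra m →ₐc[k] A, ∀ x b, (θ x).ofConv (f b) = b.1 x :=
  (hθ.existsUnique_lift' hm.isUnipotentGroup (IsHopfFunctionAlgebra.points (coeffAlgebra m))
    fun f => continuous_of_mem_coeffAlgebra hc f.2).exists

/-- Density comes from uniqueness of lifts. An element of `A` lies in some unipotent `B` with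
inclusion `i`. The map `h` restricts functions to the Zariski closure of the image of `P` in that
group, and `g` lifts that closure back to `A`. Both `g ∘ h` and `i` lift the same homomorphism, so
they agree, and `h` kills whatever vanishes on `P`. The coefficients of `m` are reached by lifting
the tautological points of `coeffAlgebra m`. -/
theorem IsContinuousUnipotentCompletion.isUnipotentHull [IsTopologicalRing k]
    {θ : P →* RationalPoints k A} (hθ : IsContinuousUnipotentCompletion θ) :
    IsUnipotentHull θ where
  prounipotent := hθ.prounipotent
  continuous := hθ.continuous
  separating a ha := by
    obtain ⟨B, _, _, i, hB, hi, ha'⟩ := hθ.prounipotent {a}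
    obtain ⟨b, rfl⟩ := ha' (Finset.mem_coe.2 (Finset.mem_singleton_self a))
    let ρ := (RationalPoints.comap i).comp θ
    have hρ : IsContinuousRep ρ := fun b => hθ.continuous (i b)
    obtain ⟨n, M, m, hm, hmM, hrange⟩ := hB.exists_rep ρ
    have := hm.isHopfFunctionAlgebra
    obtain ⟨g, hg⟩ := hθ.exists_lift_coeffAlgebra hm fun i j => by
      simp only [hmM]
      exact hρ (M i j)
    let h₀ : B →ₐ[k] coeffAlgebra m :=
      (Subalgebra.inclusion hrange.le).comp (evalHom ρ).rangeRestrict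
    let h := (IsHopfFunctionAlgebra.isSeparating_points (coeffAlgebra m)).bialgHom ρ h₀
      fun x b => rfl
    have heq : g.comp h = i :=
      (hθ.existsUnique_lift' hB ρ hρ).unique (fun x b => hg x (h b)) fun x b => rfl
    have hb : h b = 0 := Subtype.ext (funext fun x => ha x)
    rw [← heq]
    exact (congrArg g hb).trans (map_zero g)
  coeff_mem n m hm hc i j := by
    have := hm.isHopfFunctionAlgebra
    obtain ⟨f, hf⟩ := hθ.exists_lift_coeffAlgebra hm hc
    exact ⟨f (coeffMatrix m i j), funext fun x => hf x _⟩

theorem IsUnipotentHull.range_le_range [IsTopologicalRing k] {θ : P →* RationalPoints k A}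
    (hθ : IsUnipotentHull θ) {B : Type*} [CommRing B] [HopfAlgebra k B]
    {ρ : P →* RationalPoints k B} (hρ : IsUnipotentHull ρ) :
    (evalHom ρ).range ≤ (evalHom θ).range := by
  rintro _ ⟨b, rfl⟩
  obtain ⟨C, _, _, i, hC, -, hb⟩ := hρ.prounipotent {b}
  obtain ⟨c, rfl⟩ := hb (Finset.mem_coe.2 (Finset.mem_singleton_self b))
  exact hθ.range_le hC ((RationalPoints.comap i).comp ρ) (fun c => hρ.continuous (i c)) ⟨c, rfl⟩

theorem IsUnipotentHull.existsUnique_bialgEquiv [IsTopologicalRing k] {θ : P →* RationalPoints k A}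
    (hθ : IsUnipotentHull θ) {B : Type*} [CommRing B] [HopfAlgebra k B]
    {ρ : P →* RationalPoints k B} (hρ : IsUnipotentHull ρ) :
    ∃! φ : B ≃ₐc[k] A, ∀ x b, (θ x).ofConv (φ b) = (ρ x).ofConv b :=
  hθ.separating.existsUnique_bialgEquiv hρ.separating
    ((hθ.range_le_range hρ).antisymm (hρ.range_le_range hθ))

/-- For a discrete group the unipotent completion is the continuous unipotent completion. -/
theorem isUnipotentCompletion_iff [DiscreteTopology P] {θ : P →* RationalPoints k A} :
    IsUnipotentCompletion θ ↔ IsContinuousUnipotentCompletion θ :=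
  ⟨fun h => ⟨h.prounipotent, fun _ => continuous_of_discreteTopology,
      fun B _ _ hB ρ _ => h.existsUnique_lift B hB ρ⟩,
    fun h => ⟨h.prounipotent, fun B _ _ hB ρ =>
      h.existsUnique_lift B hB ρ fun _ => continuous_of_discreteTopology⟩⟩

end Hull

/-! ### Existence of unipotent completions -/

section Existence

variable (k : Type u) [Field k] [TopologicalSpace k] (P : Type w) [Group P] [TopologicalSpace P]

-- The direct sum of the two representations works. Directedness is what makes the union of all
-- coefficient algebras a subalgebra.
variable {k P} in
theorem exists_coeffAlgebra_sup {n₁ n₂ : ℕ} {m₁ : P →* Matrix (Fin n₁) (Fin n₁) k}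
    {m₂ : P →* Matrix (Fin n₂) (Fin n₂) k} (h₁ : IsUnitriangularRep m₁)
    (h₂ : IsUnitriangularRep m₂) (hc₁ : ∀ i j, Continuous fun x => m₁ x i j)
    (hc₂ : ∀ i j, Continuous fun x => m₂ x i j) :
    ∃ (n : ℕ) (m : P →* Matrix (Fin n) (Fin n) k), IsUnitriangularRep m ∧
      (∀ i j, Continuous fun x => m x i j) ∧ coeffAlgebra m₁ ≤ coeffAlgebra m ∧
      coeffAlgebra m₂ ≤ coeffAlgebra m := by
  let r : P →* Matrix (Fin n₁ ⊕ Fin n₂) (Fin n₁ ⊕ Fin n₂) k :=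
    { toFun x := Matrix.fromBlocks (m₁ x) 0 0 (m₂ x)
      map_one' := by simp
      map_mul' x y := by simp [Matrix.fromBlocks_multiply] }
  -- Each block is graded by its own positions; coincidences of degree between blocks are harmless
  -- because the mixed blocks vanish.
  obtain ⟨n, m, e, hm, hmr⟩ := exists_isUnitriangularRep (Sum.elim Fin.val Fin.val) r
    (by
      rintro x (i | i)
      · exact (h₁ x).1 i
      · exact (h₂ x).1 i)
    (by
      rintro x (i | i) (j | j) hij h
      · exact (h₁ x).2 i j (lt_of_le_of_ne h fun h' => hij (congrArg _ h'.symm))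
      · rfl
      · rfl
      · exact (h₂ x).2 i j (lt_of_le_of_ne h fun h' => hij (congrArg _ h'.symm)))
  have hr : ∀ i j, Continuous fun x => r x i j := by
    rintro (i | i) (j | j)
    · exact hc₁ i j
    · exact continuous_const
    · exact continuous_const
    · exact hc₂ i j
  refine ⟨n, m, hm, fun i j => ?_, Algebra.adjoin_le ?_, Algebra.adjoin_le ?_⟩
  · simp only [hmr]
    exact hr _ _
  · rintro _ ⟨i, j, rfl⟩
    have := coeff_mem_coeffAlgebra m (e.symm (.inl i)) (e.symm (.inl j))
    simp only [hmr, e.apply_symm_apply] at this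
    exact this
  · rintro _ ⟨i, j, rfl⟩
    have := coeff_mem_coeffAlgebra m (e.symm (.inr i)) (e.symm (.inr j))
    simp only [hmr, e.apply_symm_apply] at this
    exact this

/-- The algebra of coefficients of continuous unitriangular representations of `P` over `k`. -/
def unipotentFunctions : Subalgebra k (P → k) where
  carrier := {f | ∃ (n : ℕ) (m : P →* Matrix (Fin n) (Fin n) k), IsUnitriangularRep m ∧
      (∀ i j, Continuous fun x => m x i j) ∧ f ∈ coeffAlgebra m}
  mul_mem' := by
    rintro f g ⟨n₁, m₁, h₁, hc₁, hf⟩ ⟨n₂, m₂, h₂, hc₂, hg⟩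
    obtain ⟨n, m, hm, hc, hle₁, hle₂⟩ := exists_coeffAlgebra_sup h₁ h₂ hc₁ hc₂
    exact ⟨n, m, hm, hc, mul_mem (hle₁ hf) (hle₂ hg)⟩
  add_mem' := by
    rintro f g ⟨n₁, m₁, h₁, hc₁, hf⟩ ⟨n₂, m₂, h₂, hc₂, hg⟩
    obtain ⟨n, m, hm, hc, hle₁, hle₂⟩ := exists_coeffAlgebra_sup h₁ h₂ hc₁ hc₂
    exact ⟨n, m, hm, hc, add_mem (hle₁ hf) (hle₂ hg)⟩
  -- Constants are already in the coefficient algebra of the zero-dimensional representation.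
  algebraMap_mem' c := ⟨0, 1, fun _ => ⟨fun i => i.elim0, fun i => i.elim0⟩, fun i => i.elim0,
    algebraMap_mem _ c⟩

variable {k P} in
theorem coeffAlgebra_le_unipotentFunctions {n : ℕ} {m : P →* Matrix (Fin n) (Fin n) k}
    (hm : IsUnitriangularRep m) (hc : ∀ i j, Continuous fun x => m x i j) :
    coeffAlgebra m ≤ unipotentFunctions k P :=
  fun _ hf => ⟨n, m, hm, hc, hf⟩

variable {k P} in
theorem exists_coeffAlgebra_of_finset (s : Finset (unipotentFunctions k P)) :
    ∃ (n : ℕ) (m : P →* Matrix (Fin n) (Fin n) k), IsUnitriangularRep m ∧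
      (∀ i j, Continuous fun x => m x i j) ∧ ∀ f ∈ s, f.1 ∈ coeffAlgebra m := by
  classical
  induction s using Finset.induction_on with
  | empty => exact ⟨0, 1, fun _ => ⟨fun i => i.elim0, fun i => i.elim0⟩, fun i => i.elim0, by simp⟩
  | insert f s _ ih =>
    obtain ⟨n₁, m₁, h₁, hc₁, hs⟩ := ih
    obtain ⟨n₂, m₂, h₂, hc₂, hf⟩ := f.2
    obtain ⟨n, m, hm, hc, hle₁, hle₂⟩ := exists_coeffAlgebra_sup h₁ h₂ hc₁ hc₂
    refine ⟨n, m, hm, hc, fun g hg => ?_⟩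
    obtain rfl | hg := Finset.mem_insert.1 hg
    · exact hle₂ hf
    · exact hle₁ (hs g hg)

instance : IsHopfFunctionAlgebra (unipotentFunctions k P) where
  exists_comul := by
    rintro f ⟨n, m, hm, hc, hf⟩
    obtain ⟨t, ht⟩ := exists_comul_coeffAlgebra m f hf
    let i := Subalgebra.inclusion (coeffAlgebra_le_unipotentFunctions hm hc)
    refine ⟨Algebra.TensorProduct.map i i t, fun x y => ?_⟩
    rw [← ht]
    have : (pairPoint (evalPoint (unipotentFunctions k P) x)
        (evalPoint (unipotentFunctions k P) y)).comp (Algebra.TensorProduct.map i i) =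
        pairPoint (evalPoint _ x) (evalPoint _ y) := by
      ext f <;> simp [i]
    exact DFunLike.congr_fun this t
  inv_mem := by
    rintro f ⟨n, m, hm, hc, hf⟩
    exact ⟨n, m, hm, hc, hm.inv_mem_coeffAlgebra f hf⟩

/-- This gives all three existence statements at once: for discrete `Γ` over `ℚ`, and for the
pro-`ℓ` and profinite completions over `ℚ_ℓ`. -/
theorem isUnipotentHull_points [IsTopologicalRing k] :
    IsUnipotentHull (IsHopfFunctionAlgebra.points (unipotentFunctions k P)) where
  prounipotent s := by
    obtain ⟨n, m, hm, hc, hs⟩ := exists_coeffAlgebra_of_finset s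
    have := hm.isHopfFunctionAlgebra
    let i := Subalgebra.inclusion (coeffAlgebra_le_unipotentFunctions hm hc)
    refine ⟨coeffAlgebra m, inferInstance, inferInstance,
      (IsHopfFunctionAlgebra.isSeparating_points (unipotentFunctions k P)).bialgHom
        (IsHopfFunctionAlgebra.points (coeffAlgebra m)) i fun x f => rfl, hm.isUnipotentGroup,
      Subalgebra.inclusion_injective (coeffAlgebra_le_unipotentFunctions hm hc), fun f hf => ⟨⟨f.1, hs f hf⟩, rfl⟩⟩
  continuous f := by
    obtain ⟨n, m, hm, hc, hf⟩ := f.2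
    exact continuous_of_mem_coeffAlgebra hc hf
  separating := IsHopfFunctionAlgebra.isSeparating_points _
  coeff_mem n m hm hc i j :=
    ⟨⟨_, coeffAlgebra_le_unipotentFunctions hm hc (coeff_mem_coeffAlgebra m i j)⟩, rfl⟩

end Existence

/-! ### Restriction of scalars of unitriangular representations -/

section RestrictScalars

variable {k K Γ : Type*} [Field k] [Field K] [Algebra k K] [Group Γ] [Group.FG Γ] {n : ℕ}

/-- The coefficient at `(i, j)` of a unitriangular representation of a finitely generated group
lies in the `(j - i)`-th power of a finite-dimensional space. -/
theorem IsUnitriangularRep.exists_mem_pow {r : Γ →* Matrix (Fin n) (Fin n) K}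
    (hr : IsUnitriangularRep r) : ∃ V : Submodule k K, V.FG ∧ 1 ≤ V ∧
      ∀ γ, ∀ i j : Fin n, i ≤ j → r γ i j ∈ V ^ (j - i : ℕ) := by
  -- Generators as a monoid are used, so the induction has no case for inverses.
  obtain ⟨S, hS⟩ := (Monoid.fg_def.1 (inferInstance : Monoid.FG Γ) : (⊤ : Submonoid Γ).FG)
  -- Including `1` makes the powers of the span increasing, so a generator's entry lies in every
  -- positive power.
  let E : Set K := insert 1 (Set.range fun p : S × Fin n × Fin n => r p.1 p.2.1 p.2.2)
  have hE : E.Finite := (Set.finite_range _).insert _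
  have h1 : 1 ≤ Submodule.span k E := Submodule.one_le.2 (Submodule.subset_span (by simp [E]))
  refine ⟨Submodule.span k E, Submodule.fg_span hE, h1, fun γ => ?_⟩
  have hγ : γ ∈ Submonoid.closure (S : Set Γ) := hS ▸ Submonoid.mem_top γ
  induction hγ using Submonoid.closure_induction with
  | mem γ hγ =>
    intro i j hij
    obtain rfl | hlt := hij.eq_or_lt
    · rw [(hr γ).1, Nat.sub_self, pow_zero]
      exact Submodule.one_le.1 le_rfl
    · have h2 : Submodule.span k E ≤ Submodule.span k E ^ (j - i : ℕ) :=
        le_self_pow h1 (by have : i.val < j.val := hlt; omega)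
      exact h2 (Submodule.subset_span (Or.inr ⟨(⟨γ, hγ⟩, i, j), rfl⟩))
  | one =>
    intro i j hij
    rw [map_one, Matrix.one_apply]
    split_ifs with h
    · rw [h, Nat.sub_self, pow_zero]
      exact Submodule.one_le.1 le_rfl
    · exact zero_mem _
  -- Only `i ≤ l ≤ j` contribute, and the exponents `l - i` and `j - l` add up to `j - i`: the bound
  -- does not grow with word length.
  | mul x y _ _ hx hy =>
    intro i j hij
    rw [map_mul, Matrix.mul_apply]
    refine sum_mem fun l _ => ?_
    obtain h | h := lt_or_ge l i
    · rw [(hr x).2 i l h, zero_mul]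
      exact zero_mem _
    obtain h' | h' := lt_or_ge j l
    · rw [(hr y).2 l j h', mul_zero]
      exact zero_mem _
    have : (j - i : ℕ) = (l - i) + (j - l) := by
      have : i.val ≤ l.val := h
      have : l.val ≤ j.val := h'
      omega
    rw [this, pow_add]
    exact Submodule.mul_mem_mul (hx i l h) (hy l j h')

variable (k) in
/-- The coefficients over `K` of unitriangular representations of a finitely generated group are
linear combinations of coefficients of such representations over a subfield `k`. -/
theorem IsUnitriangularRep.mem_span_coeff {r : Γ →* Matrix (Fin n) (Fin n) K}
    (hr : IsUnitriangularRep r) (i j : Fin n) :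
    (fun γ => r γ i j) ∈ Submodule.span K {g : Γ → K | ∃ (N : ℕ)
      (m : Γ →* Matrix (Fin N) (Fin N) k), IsUnitriangularRep m ∧ ∃ a b,
        g = fun γ => algebraMap k K (m γ a b)} := by
  classical
  obtain ⟨V, hV, h1, hrV⟩ := hr.exists_mem_pow (k := k)
  -- A finite-dimensional `k`-subspace of the column vectors `K ^ n`. It is stable under `Γ` because
  -- an entry in `V ^ (j - i)` carries `V ^ (n - j)` into `V ^ (n - i)`.
  let W := (j : Fin n) → ↥(V ^ (n - j : ℕ))
  have hmem : ∀ γ (w : W) (i : Fin n), ∑ j, r γ i j * (w j : K) ∈ V ^ (n - i : ℕ) := by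
    intro γ w i
    refine sum_mem fun j _ => ?_
    obtain h | h := lt_or_ge j i
    · rw [(hr γ).2 i j h, zero_mul]
      exact zero_mem _
    · have : (n - i : ℕ) = (j - i) + (n - j) := by
        have : i.val ≤ j.val := h
        omega
      rw [this, pow_add]
      exact Submodule.mul_mem_mul (hrV γ i j h) (w j).2
  let T : Γ →* Module.End k W :=
    { toFun γ :=
        { toFun w i := ⟨∑ j, r γ i j * (w j : K), hmem γ w i⟩
          map_add' w w' := by
            refine funext fun i => Subtype.ext ?_
            change ∑ j, r γ i j * ((w j : K) + w' j) = ∑ j, r γ i j * (w j : K) +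
              ∑ j, r γ i j * (w' j : K)
            simp only [mul_add, Finset.sum_add_distrib]
          map_smul' c w := by
            refine funext fun i => Subtype.ext ?_
            change ∑ j, r γ i j * (c • (w j : K)) = c • ∑ j, r γ i j * (w j : K)
            simp only [Finset.smul_sum, mul_smul_comm] }
      map_one' := by
        ext w i
        simp [Matrix.one_apply]
      map_mul' x y := by
        refine LinearMap.ext fun w => funext fun i => Subtype.ext ?_
        change ∑ j, r (x * y) i j * (w j : K) = ∑ l, r x i l * ∑ j, r y l j * (w j : K)
        simp only [map_mul, Matrix.mul_apply, Finset.sum_mul, Finset.mul_sum, mul_assoc]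
        exact Finset.sum_comm }
  have hT : ∀ γ w i, ((T γ w i : K)) = ∑ j, r γ i j * (w j : K) := fun _ _ _ => rfl
  have hTs : ∀ γ (i j : Fin n) (v : ↥(V ^ (n - j : ℕ))),
      (T γ (Pi.single j v) i : K) = r γ i j * v := by
    intro γ i j v
    rw [hT, Finset.sum_eq_single j]
    · simp
    · intro l _ hl
      simp [Pi.single_eq_of_ne hl]
    · simp
  have hfin : ∀ j : Fin n, Module.Finite k ↥(V ^ (n - j : ℕ)) := fun j =>
    Module.Finite.iff_fg.2 (hV.pow _)
  let β := fun j : Fin n => Module.finBasis k ↥(V ^ (n - j : ℕ))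
  let b := Pi.basis β
  let m := (MonoidHomClass.toMonoidHom (LinearMap.toMatrixAlgEquiv b)).comp T
  have hm : ∀ γ s t, m γ s t = (β s.1).repr (T γ (Pi.single t.1 (β t.1 t.2)) s.1) s.2 := by
    intro γ s t
    change LinearMap.toMatrixAlgEquiv b (T γ) s t = _
    rw [LinearMap.toMatrixAlgEquiv_apply, Pi.basis_apply, Pi.basis_repr]
  -- Basis vectors are graded by their block. Within a block `T γ` is the identity, since `r γ i i =
  -- 1`, and it has no component below.
  obtain ⟨N, m', e, hm', hmm⟩ := exists_isUnitriangularRep (fun s => s.1.val) m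
    (by
      rintro γ ⟨i, a⟩
      have : T γ (Pi.single i (β i a)) i = β i a := Subtype.ext (by
        rw [hTs, (hr γ).1, one_mul])
      rw [hm]
      simp [this])
    (by
      rintro γ ⟨i, a⟩ ⟨j, c⟩ hne h
      rw [hm]
      obtain rfl | h := (show j ≤ i from h).eq_or_lt
      · have : T γ (Pi.single j (β j c)) j = β j c := Subtype.ext (by
          rw [hTs, (hr γ).1, one_mul])
        have hac : c ≠ a := fun h => hne (by rw [h])
        simp [this, hac]
      · have : T γ (Pi.single j (β j c)) i = 0 := Subtype.ext (by
          rw [hTs, (hr γ).2 i j h, zero_mul]; rfl)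
        simp [this])
  have h1V : (1 : K) ∈ V ^ (n - j : ℕ) := Submodule.one_le.1 (one_le_pow_of_one_le' h1 _)
  -- The `j`-th standard vector, so that `r γ i j` is the `i`-th component of `T γ w`; expanding in
  -- the bases writes it through entries of `m`.
  let w : W := Pi.single j ⟨1, h1V⟩
  have key : (fun γ => r γ i j) = ∑ a, ∑ t, (b.repr w t • (β i a : K)) •
      fun γ => algebraMap k K (m' γ (e.symm ⟨i, a⟩) (e.symm t)) := by
    funext γ
    have h2 : r γ i j = (T γ w i : K) := by rw [hTs, mul_one]
    rw [h2, ← (β i).sum_repr (T γ w i)]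
    simp only [Finset.sum_apply, Pi.smul_apply, hmm, e.apply_symm_apply, Submodule.coe_sum,
      Submodule.coe_smul]
    refine Finset.sum_congr rfl fun a _ => ?_
    have h3 : (β i).repr (T γ w i) a = ∑ t, m γ ⟨i, a⟩ t * b.repr w t := by
      have := congrFun (LinearMap.toMatrix_mulVec_repr b b (T γ) w) ⟨i, a⟩
      rw [Pi.basis_repr] at this
      exact this.symm
    rw [h3, Finset.sum_smul]
    refine Finset.sum_congr rfl fun t _ => ?_
    simp only [Algebra.smul_def, Algebra.algebraMap_self, RingHom.id_apply, map_mul]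
    ring
  rw [key]
  exact sum_mem fun a _ => sum_mem fun t _ => Submodule.smul_mem _ _ <|
    Submodule.subset_span ⟨N, m', hm', _, _, rfl⟩

end RestrictScalars

/-! ### Base change -/

section BaseChange

variable {k : Type u} (K : Type w) [Field k] [Field K] [Algebra k K]
  {A : Type v} [CommRing A] [HopfAlgebra k A]

theorem extendPoint_tmul (x : RationalPoints k A) (c : K) (a : A) :
    (extendPoint K x).ofConv (c ⊗ₜ a) = c * algebraMap k K (x.ofConv a) := by
  simp [extendPoint, Algebra.ofId_apply]

/-- The canonical map `A ⊗ A → A_K ⊗ A_K`. -/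
def baseChangeTensor : A ⊗[k] A →ₗ[k] (K ⊗[k] A) ⊗[K] (K ⊗[k] A) :=
  TensorProduct.lift <| LinearMap.mk₂ k (fun a b => (1 ⊗ₜ[k] a) ⊗ₜ[K] (1 ⊗ₜ[k] b))
    (fun a a' b => by rw [TensorProduct.tmul_add, TensorProduct.add_tmul])
    (fun c a b => by rw [TensorProduct.tmul_smul]; rfl)
    (fun a b b' => by rw [TensorProduct.tmul_add, TensorProduct.tmul_add])
    (fun c a b => by rw [TensorProduct.tmul_smul, TensorProduct.tmul_smul])

theorem baseChangeTensor_tmul (a b : A) :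
    baseChangeTensor K (k := k) (a ⊗ₜ b) = (1 ⊗ₜ[k] a) ⊗ₜ[K] (1 ⊗ₜ[k] b) := rfl

theorem comul_one_tmul (a : A) : Coalgebra.comul (R := K) ((1 : K) ⊗ₜ[k] a) =
    baseChangeTensor K (Coalgebra.comul (R := k) a) := by
  rw [TensorProduct.comul_tmul]
  generalize Coalgebra.comul (R := k) a = t
  induction t with
  | zero => simp
  | tmul a b => rfl
  | add s t hs ht => rw [TensorProduct.tmul_add, map_add, map_add, hs, ht]

theorem pairPoint_baseChangeTensor (x y : RationalPoints k A) (t : A ⊗[k] A) :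
    pairPoint (extendPoint K x).ofConv (extendPoint K y).ofConv (baseChangeTensor K t) =
      algebraMap k K (pairPoint x.ofConv y.ofConv t) := by
  induction t with
  | zero => simp
  | tmul a b =>
    rw [baseChangeTensor_tmul, Algebra.TensorProduct.lift_tmul, Algebra.TensorProduct.lift_tmul,
      extendPoint_tmul, extendPoint_tmul, one_mul, one_mul, map_mul]
  | add s t hs ht => rw [map_add, map_add, map_add, map_add, hs, ht]

/-- Base change of rational points is a group homomorphism. -/
def extendPointHom : RationalPoints k A →* RationalPoints K (K ⊗[k] A) where
  toFun := extendPoint K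
  map_one' := by
    apply WithConv.ofConv_injective
    ext a
    change (extendPoint K (1 : RationalPoints k A)).ofConv ((1 : K) ⊗ₜ a) =
      Coalgebra.counit (R := K) ((1 : K) ⊗ₜ[k] a)
    rw [extendPoint_tmul, RationalPoints.one_apply]
    simp [Algebra.smul_def]
  map_mul' x y := by
    apply WithConv.ofConv_injective
    ext a
    change (extendPoint K (x * y)).ofConv ((1 : K) ⊗ₜ a) =
      (extendPoint K x * extendPoint K y).ofConv ((1 : K) ⊗ₜ a)
    rw [extendPoint_tmul, RationalPoints.mul_apply, RationalPoints.mul_apply, one_mul,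
      comul_one_tmul, pairPoint_baseChangeTensor]

@[simp]
theorem extendPointHom_apply (x : RationalPoints k A) : extendPointHom K x = extendPoint K x := rfl

theorem IsUnipotentGroup.baseChange (hA : IsUnipotentGroup k A) :
    IsUnipotentGroup K (K ⊗[k] A) := by
  obtain ⟨n, M, h1, h0, hε, hδ, htop⟩ := hA
  refine ⟨n, M.map fun a => 1 ⊗ₜ a, fun i => ?_, fun i j h => ?_, fun i j => ?_, fun i j => ?_, ?_⟩
  · rw [Matrix.map_apply, h1]; rfl
  · rw [Matrix.map_apply, h0 i j h, TensorProduct.tmul_zero]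
  · rw [Matrix.map_apply, TensorProduct.counit_tmul, hε]
    split_ifs <;> simp
  · rw [Matrix.map_apply, comul_one_tmul, hδ, map_sum]
    rfl
  · refine top_unique fun t _ => ?_
    have h : ∀ a : A, (1 : K) ⊗ₜ[k] a ∈ Algebra.adjoin K
        {b | ∃ i j, M.map (fun a => (1 : K) ⊗ₜ[k] a) i j = b} := by
      intro a
      have ha : a ∈ Algebra.adjoin k {b | ∃ i j, M i j = b} := htop ▸ Algebra.mem_top
      induction ha using Algebra.adjoin_induction with
      | mem a ha =>
        obtain ⟨i, j, rfl⟩ := ha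
        exact Algebra.subset_adjoin ⟨i, j, rfl⟩
      | algebraMap c =>
        rw [Algebra.algebraMap_eq_smul_one, ← TensorProduct.smul_tmul, Algebra.smul_def, mul_one]
        exact algebraMap_mem _ (algebraMap k K c)
      | add a b _ _ ha hb => rw [TensorProduct.tmul_add]; exact add_mem ha hb
      | mul a b _ _ ha hb =>
        have := mul_mem ha hb
        rwa [Algebra.TensorProduct.tmul_mul_tmul, one_mul] at this
    induction t with
    | zero => exact zero_mem _
    | tmul c a =>
      have := Subalgebra.smul_mem _ (h a) c
      rwa [TensorProduct.smul_tmul', smul_eq_mul, mul_one] at this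
    | add s t hs ht => exact add_mem (hs Algebra.mem_top) (ht Algebra.mem_top)

/-- A tensor involves only finitely many elements of `A`. This reduces prounipotence of the base
change to that of `A`. -/
theorem exists_finset_tensorProduct (t : K ⊗[k] A) : ∃ T : Finset A,
    ∀ (B : Type v) [CommRing B] [HopfAlgebra k B] (f : B →ₐc[k] A), (T : Set A) ⊆ Set.range f →
      t ∈ Set.range (Bialgebra.TensorProduct.map (BialgHom.id K K) f) := by
  classical
  induction t with
  | zero => exact ⟨∅, fun B _ _ f _ => ⟨0, map_zero _⟩⟩
  | tmul c a =>
    refine ⟨{a}, fun B _ _ f hf => ?_⟩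
    obtain ⟨b, hb⟩ := hf (Finset.mem_coe.2 (Finset.mem_singleton_self a))
    exact ⟨c ⊗ₜ b, by simp [hb]⟩
  | add s t hs ht =>
    obtain ⟨S, hS⟩ := hs
    obtain ⟨T, hT⟩ := ht
    refine ⟨S ∪ T, fun B _ _ f hf => ?_⟩
    rw [Finset.coe_union, Set.union_subset_iff] at hf
    obtain ⟨x, rfl⟩ := hS B f hf.1
    obtain ⟨y, rfl⟩ := hT B f hf.2
    exact ⟨x + y, map_add _ _ _⟩

theorem IsProunipotentGroup.baseChange (hA : IsProunipotentGroup k A) :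
    IsProunipotentGroup K (K ⊗[k] A) := by
  classical
  intro s
  choose T hT using exists_finset_tensorProduct K (k := k) (A := A)
  obtain ⟨B, _, _, f, hB, hf, hs⟩ := hA (s.biUnion T)
  refine ⟨K ⊗[k] B, inferInstance, inferInstance, Bialgebra.TensorProduct.map (BialgHom.id K K) f,
    hB.baseChange K, ?_, fun t ht => hT t B f fun a ha => hs ?_⟩
  · exact Module.Flat.lTensor_preserves_injective_linearMap (M := K)
      ((f : B →ₐ[k] A).toLinearMap) hf
  · exact Finset.mem_coe.2 (Finset.mem_biUnion.2 ⟨t, ht, ha⟩)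

theorem rid_lTensor_eq_extendPoint (x : RationalPoints k A) (t : K ⊗[k] A) :
    TensorProduct.rid k K (x.ofConv.toLinearMap.lTensor K t) = (extendPoint K x).ofConv t := by
  induction t with
  | zero => simp
  | tmul c a =>
    rw [extendPoint_tmul]
    simp [Algebra.smul_def, mul_comm]
  | add s t hs ht => rw [map_add, map_add, map_add, hs, ht]

-- The points over `k` separate `A` as linear functionals, and expansion in a basis of `K` over `k`
-- carries this over to `K ⊗ A`.
variable {K} in
theorem IsSeparating.baseChange {Γ : Type*} [Group Γ] {θ : Γ →* RationalPoints k A}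
    (hθ : IsSeparating θ) : IsSeparating ((extendPointHom K).comp θ) := fun t ht =>
  TensorProduct.eq_zero_of_forall_lTensor (fun γ => (θ γ).ofConv.toLinearMap) hθ t fun γ =>
    (rid_lTensor_eq_extendPoint K (θ γ) t).trans (ht γ)

/-- For a finitely generated discrete group, base change of the unipotent completion is the
unipotent completion over the larger field. -/
theorem IsUnipotentHull.baseChange [TopologicalSpace k] [TopologicalSpace K] {Γ : Type w'} [Group Γ]
    [Group.FG Γ] [TopologicalSpace Γ] [DiscreteTopology Γ] {θ : Γ →* RationalPoints k A}
    (hθ : IsUnipotentHull θ) : IsUnipotentHull ((extendPointHom K).comp θ) where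
  prounipotent := hθ.prounipotent.baseChange K
  continuous _ := continuous_of_discreteTopology
  separating := hθ.separating.baseChange
  coeff_mem n r hr _ i j := by
    have hle : Submodule.span K {g : Γ → K | ∃ (N : ℕ)
        (m : Γ →* Matrix (Fin N) (Fin N) k), IsUnitriangularRep m ∧ ∃ a b,
          g = fun γ => algebraMap k K (m γ a b)} ≤
        Subalgebra.toSubmodule (evalHom ((extendPointHom K).comp θ)).range := by
      refine Submodule.span_le.2 ?_
      rintro _ ⟨N, m, hm, a, b, rfl⟩
      obtain ⟨f, hf⟩ := hθ.coeff_mem N m hm (fun _ _ => continuous_of_discreteTopology) a b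
      refine ⟨1 ⊗ₜ f, funext fun γ => ?_⟩
      refine (extendPoint_tmul K (θ γ) 1 f).trans ?_
      rw [one_mul]
      exact congrArg (algebraMap k K) (congrFun hf γ)
    exact hle (hr.mem_span_coeff k i j)

end BaseChange

/-! ### Integrality of unitriangular representations over `ℚ_ℓ` -/

section Padic

variable {ℓ : ℕ} [Fact ℓ.Prime] {Γ : Type*} [Group Γ] {n : ℕ}

/-- The degree count of `IsUnitriangularRep.exists_mem_pow`, with the lattice `ℓ ^ (-c) ℤ_ℓ` in
place of `V`; the ultrametric inequality handles the sums. -/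
theorem IsUnitriangularRep.exists_norm_le [Group.FG Γ] {r : Γ →* Matrix (Fin n) (Fin n) ℚ_[ℓ]}
    (hr : IsUnitriangularRep r) : ∃ c : ℕ, ∀ γ, ∀ i j : Fin n, i ≤ j →
      ‖(ℓ : ℚ_[ℓ]) ^ (c * (j - i : ℕ)) * r γ i j‖ ≤ 1 := by
  obtain ⟨S, hS⟩ := (Monoid.fg_def.1 (inferInstance : Monoid.FG Γ) : (⊤ : Submonoid Γ).FG)
  have hex : ∀ x : ℚ_[ℓ], ∃ c : ℕ, ‖(ℓ : ℚ_[ℓ]) ^ c * x‖ ≤ 1 := by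
    intro x
    obtain ⟨c, hc⟩ := exists_pow_lt_of_lt_one (y := ‖(ℓ : ℚ_[ℓ])‖) (x := (1 + ‖x‖)⁻¹)
      (by positivity) Padic.norm_p_lt_one
    refine ⟨c, ?_⟩
    rw [norm_mul, norm_pow]
    calc _ ≤ (1 + ‖x‖)⁻¹ * (1 + ‖x‖) := by
          gcongr
          linarith
      _ = 1 := inv_mul_cancel₀ (by positivity)
  choose C hC using hex
  -- The sum serves merely as an upper bound for the exponents of all generator entries.
  let c := ∑ p : S × Fin n × Fin n, C (r p.1 p.2.1 p.2.2)
  have hmono : ∀ (x : ℚ_[ℓ]) (a b : ℕ), a ≤ b → ‖(ℓ : ℚ_[ℓ]) ^ a * x‖ ≤ 1 →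
      ‖(ℓ : ℚ_[ℓ]) ^ b * x‖ ≤ 1 := by
    intro x a b hab h
    rw [← Nat.sub_add_cancel hab, pow_add, mul_assoc, norm_mul]
    refine mul_le_one₀ ?_ (norm_nonneg _) h
    rw [norm_pow]
    exact pow_le_one₀ (norm_nonneg _) Padic.norm_p_lt_one.le
  refine ⟨c, fun γ => ?_⟩
  have hγ : γ ∈ Submonoid.closure (S : Set Γ) := hS ▸ Submonoid.mem_top γ
  induction hγ using Submonoid.closure_induction with
  | mem γ hγ =>
    intro i j hij
    obtain rfl | hlt := hij.eq_or_lt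
    · simp [(hr γ).1]
    · refine hmono _ _ _ ?_ (hC _)
      refine (Finset.single_le_sum (f := fun p : S × Fin n × Fin n => C (r p.1 p.2.1 p.2.2))
        (fun _ _ => Nat.zero_le _) (Finset.mem_univ (⟨γ, hγ⟩, i, j))).trans ?_
      exact Nat.le_mul_of_pos_right _ (Nat.sub_pos_of_lt hlt)
  | one =>
    intro i j hij
    rw [map_one, Matrix.one_apply]
    split_ifs with h
    · simp [h]
    · simp
  | mul x y _ _ hx hy =>
    intro i j hij
    rw [map_mul, Matrix.mul_apply, Finset.mul_sum]
    refine IsUltrametricDist.norm_sum_le_of_forall_le_of_nonneg zero_le_one fun l _ => ?_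
    obtain h | h := lt_or_ge l i
    · simp [(hr x).2 i l h]
    obtain h' | h' := lt_or_ge j l
    · simp [(hr y).2 l j h']
    have : (j - i : ℕ) = (l - i) + (j - l) := by
      have : i.val ≤ l.val := h
      have : l.val ≤ j.val := h'
      omega
    rw [this, mul_add, pow_add, mul_mul_mul_comm, norm_mul]
    exact mul_le_one₀ (hx i l h) (norm_nonneg _) (hy l j h')

/-- A unitriangular representation of a finitely generated group over `ℚ_ℓ` is conjugate by a
diagonal matrix to one over `ℤ_ℓ`. -/
theorem IsUnitriangularRep.exists_integral [Group.FG Γ] {r : Γ →* Matrix (Fin n) (Fin n) ℚ_[ℓ]}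
    (hr : IsUnitriangularRep r) : ∃ (c : ℕ) (s : Γ →* Matrix (Fin n) (Fin n) ℤ_[ℓ]),
      (∀ γ i, s γ i i = 1) ∧ (∀ γ i j, j < i → s γ i j = 0) ∧
      ∀ γ i j, (ℓ : ℚ_[ℓ]) ^ (c * i.val) * (s γ i j : ℚ_[ℓ]) = (ℓ : ℚ_[ℓ]) ^ (c * j.val) * r γ i j := by
  obtain ⟨c, hc⟩ := hr.exists_norm_le
  have hℓ : (ℓ : ℚ_[ℓ]) ≠ 0 := Nat.cast_ne_zero.2 (Fact.out : ℓ.Prime).ne_zero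
  -- This is `D⁻¹ r D` for `D` diagonal with entries `ℓ ^ (c * i)`. The relation `hs` expresses it
  -- without dividing by `ℓ`.
  let s₀ : Γ → Matrix (Fin n) (Fin n) ℤ_[ℓ] := fun γ => Matrix.of fun i j =>
    if h : i ≤ j then ⟨_, hc γ i j h⟩ else 0
  have hpos : ∀ γ i j (h : i ≤ j), s₀ γ i j = ⟨_, hc γ i j h⟩ := fun γ i j h => dif_pos h
  have hneg : ∀ γ i j, j < i → s₀ γ i j = 0 := fun γ i j h => dif_neg (not_le.2 h)
  have hs : ∀ γ i j,
      (ℓ : ℚ_[ℓ]) ^ (c * i.val) * (s₀ γ i j : ℚ_[ℓ]) = (ℓ : ℚ_[ℓ]) ^ (c * j.val) * r γ i j := by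
    intro γ i j
    by_cases h : i ≤ j
    · have h' : i.val ≤ j.val := h
      rw [hpos γ i j h]
      change _ * (_ * _) = _
      rw [← mul_assoc, ← pow_add, ← mul_add, Nat.add_sub_of_le h']
    · simp [hneg γ i j (not_le.1 h), (hr γ).2 i j (not_le.1 h)]
  have hinj : ∀ {x y : ℤ_[ℓ]} (i : Fin n),
      (ℓ : ℚ_[ℓ]) ^ (c * i.val) * (x : ℚ_[ℓ]) = (ℓ : ℚ_[ℓ]) ^ (c * i.val) * (y : ℚ_[ℓ]) → x = y :=
    fun i h => Subtype.ext (mul_left_cancel₀ (pow_ne_zero _ hℓ) h)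
  refine ⟨c, ⟨⟨s₀, ?_⟩, ?_⟩, fun γ i => ?_, fun γ i j h => ?_, hs⟩
  · ext1 i j
    refine hinj i ?_
    rw [hs, map_one]
    by_cases h : i = j
    · rw [h, Matrix.one_apply_eq, Matrix.one_apply_eq, PadicInt.coe_one]
    · rw [Matrix.one_apply_ne h, Matrix.one_apply_ne h, PadicInt.coe_zero, mul_zero, mul_zero]
  · intro x y
    ext1 i j
    refine hinj i ?_
    rw [hs, map_mul, Matrix.mul_apply, Matrix.mul_apply, PadicInt.coe_sum, Finset.mul_sum,
      Finset.mul_sum]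
    refine Finset.sum_congr rfl fun l _ => ?_
    have h1 := hs x i l
    have h2 := hs y l j
    rw [PadicInt.coe_mul]
    change _ = (ℓ : ℚ_[ℓ]) ^ (c * i.val) * ((s₀ x i l : ℚ_[ℓ]) * (s₀ y l j : ℚ_[ℓ]))
    linear_combination -(s₀ y l j : ℚ_[ℓ]) * h1 - r x i l * h2
  · refine hinj i ?_
    change _ * (s₀ γ i i : ℚ_[ℓ]) = _
    rw [hs, (hr γ).1]
    simp
  · exact hneg γ i j h

end Padic

/-! ### Finite quotients -/

section FiniteQuotient

/-- The group of upper triangular matrices with ones on the diagonal over a finite ring. -/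
def unitriangularSubgroup (R : Type*) [CommRing R] [Finite R] (n : ℕ) :
    Subgroup (Matrix (Fin n) (Fin n) R)ˣ :=
  let S : Submonoid (Matrix (Fin n) (Fin n) R)ˣ :=
    { carrier := {u | (∀ i, u.1 i i = 1) ∧ ∀ i j, j < i → u.1 i j = 0}
      one_mem' := ⟨fun i => Matrix.one_apply_eq i, fun i j h => Matrix.one_apply_ne h.ne'⟩
      mul_mem' := by
        rintro u v ⟨hu1, hu0⟩ ⟨hv1, hv0⟩
        refine ⟨fun i => ?_, fun i j hij => ?_⟩
        · rw [Units.val_mul, Matrix.mul_apply, Finset.sum_eq_single i, hu1, hv1, one_mul]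
          · intro l _ hl
            obtain h | h := hl.lt_or_gt
            · rw [hu0 i l h, zero_mul]
            · rw [hv0 l i h, mul_zero]
          · simp
        · rw [Units.val_mul, Matrix.mul_apply]
          refine Finset.sum_eq_zero fun l _ => ?_
          obtain h | h := lt_or_ge l i
          · rw [hu0 i l h, zero_mul]
          · rw [hv0 l j (hij.trans_le h), mul_zero] }
  { S with
    inv_mem' := fun {u} hu => by
      -- In a finite group the inverse is a power, so a submonoid is closed under inverses.
      have h : u⁻¹ ∈ Submonoid.powers u := by
        rw [(isOfFinOrder_of_finite u).mem_powers_iff_mem_zpowers]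
        exact inv_mem (Subgroup.mem_zpowers u)
      exact (Submonoid.powers_le (P := S)).2 hu h }

theorem card_unitriangularSubgroup (R : Type*) [CommRing R] [Finite R] (n : ℕ) :
    Nat.card (unitriangularSubgroup R n) =
      Nat.card R ^ Nat.card {p : Fin n × Fin n // p.1 < p.2} := by
  rw [← Nat.card_fun]
  refine Nat.card_congr (Equiv.ofBijective (fun u p => u.1.1 p.1.1 p.1.2) ⟨fun u v h => ?_,
    fun f => ?_⟩)
  · refine Subtype.ext (Units.ext (Matrix.ext fun i j => ?_))
    obtain hlt | rfl | hlt := lt_trichotomy i j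
    · exact congrFun h ⟨(i, j), hlt⟩
    · rw [u.2.1, v.2.1]
    · rw [u.2.2 _ _ hlt, v.2.2 _ _ hlt]
  · let M : Matrix (Fin n) (Fin n) R := Matrix.of fun i j =>
      if h : i < j then f ⟨(i, j), h⟩ else if i = j then 1 else 0
    have h1 : ∀ i, M i i = 1 := fun i => by simp [M]
    have h0 : ∀ i j, j < i → M i j = 0 := fun i j h => by simp [M, h.not_gt, h.ne']
    have hM : IsUnit M := by
      rw [Matrix.isUnit_iff_isUnit_det, Matrix.det_of_isUpperTriangular fun i j h => h0 i j h]
      simp [h1]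
    refine ⟨⟨hM.unit, h1, h0⟩, funext fun p => ?_⟩
    simp [M, p.2]

/-- The kernel of a unitriangular representation over a finite `ℓ`-primary ring has `ℓ`-power
index. -/
theorem exists_index_ker_eq_pow {R Γ : Type*} [CommRing R] [Finite R] [Group Γ] {n : ℕ}
    (s : Γ →* Matrix (Fin n) (Fin n) R) (h1 : ∀ γ i, s γ i i = 1)
    (h0 : ∀ γ i j, j < i → s γ i j = 0) {ℓ a : ℕ} [Fact ℓ.Prime] (hR : Nat.card R = ℓ ^ a) :
    ∃ N : ℕ, s.toHomUnits.ker.index = ℓ ^ N := by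
  have hle : s.toHomUnits.range ≤ unitriangularSubgroup R n := by
    rintro _ ⟨γ, rfl⟩
    exact ⟨h1 γ, h0 γ⟩
  have hdvd := Subgroup.card_dvd_of_le hle
  rw [card_unitriangularSubgroup, hR, ← pow_mul] at hdvd
  obtain ⟨N, -, hN⟩ := (Nat.dvd_prime_pow Fact.out).1 hdvd
  exact ⟨N, by rw [Subgroup.index_ker, hN]⟩

end FiniteQuotient

/-! ### Extension of unitriangular representations to completions -/

section Extension

open Filter Topology

/-- The hypothesis is a Cauchy condition at every point of `P`, not only at points of the image, so
completeness of `E` supplies the limits without a uniform structure on `P`. -/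
theorem DenseRange.exists_continuous_extension {Γ P E : Type*} [TopologicalSpace P]
    [MetricSpace E] [CompleteSpace E] {π : Γ → P} (hπ : DenseRange π) {f : Γ → E}
    (hf : ∀ x, ∀ ε > 0, ∃ U ∈ 𝓝 x, ∀ γ γ', π γ ∈ U → π γ' ∈ U → dist (f γ) (f γ') < ε) :
    ∃ g : P → E, Continuous g ∧ ∀ γ, g (π γ) = f γ := by
  let _ : TopologicalSpace Γ := .induced π inferInstance
  have di : IsDenseInducing π := ⟨⟨rfl⟩, hπ⟩
  have hfc : Continuous f := by
    refine continuous_iff_continuousAt.2 fun γ => Metric.continuousAt_iff'.2 fun ε hε => ?_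
    obtain ⟨U, hU, h⟩ := hf (π γ) ε hε
    rw [di.nhds_eq_comap]
    filter_upwards [preimage_mem_comap hU] with γ' hγ'
    exact h γ' γ hγ' (mem_of_mem_nhds hU)
  refine ⟨di.extend f, di.continuous_extend fun x => ?_, di.extend_eq hfc⟩
  have := di.comap_nhds_neBot x
  refine CompleteSpace.complete (Metric.cauchy_iff.2 ⟨inferInstance, fun ε hε => ?_⟩)
  obtain ⟨U, hU, h⟩ := hf x ε hε
  refine ⟨f '' (π ⁻¹' U), image_mem_map (preimage_mem_comap hU), ?_⟩
  rintro _ ⟨γ, hγ, rfl⟩ _ ⟨γ', hγ', rfl⟩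
  exact h γ γ' hγ hγ'

/-- `π` has dense image, and the topology of `P` induces on `Γ` a topology that is at least as fine
as the pro-`ℓ` topology. -/
structure IsPrimePowerDense (ℓ : ℕ) {Γ P : Type*} [Group Γ] [Group P] [TopologicalSpace P]
    (π : Γ →* P) : Prop where
  denseRange : DenseRange π
  exists_nhds : ∀ N : Subgroup Γ, N.Normal → (∃ a : ℕ, N.index = ℓ ^ a) → ∀ x : P,
    ∃ U ∈ 𝓝 x, ∀ γ γ', π γ ∈ U → π γ' ∈ U → γ⁻¹ * γ' ∈ N

variable {ℓ : ℕ} [Fact ℓ.Prime] {Γ P : Type*} [Group Γ] [Group P] [TopologicalSpace P]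
  [ContinuousMul P] {π : Γ →* P} {n : ℕ}

/-- Take the kernel of reduction modulo `ℓ ^ a` with `ℓ ^ (-a) < ε`. Unitriangular matrices over `ℤ
/ ℓ ^ a` form a finite `ℓ`-group, which is why quotients of order prime to `ℓ` play no role and the
profinite and pro-`ℓ` completions agree. -/
theorem exists_subgroup_dist_lt (s : Γ →* Matrix (Fin n) (Fin n) ℤ_[ℓ]) (h1 : ∀ γ i, s γ i i = 1)
    (h0 : ∀ γ i j, j < i → s γ i j = 0) {ε : ℝ} (hε : 0 < ε) :
    ∃ N : Subgroup Γ, N.Normal ∧ (∃ a : ℕ, N.index = ℓ ^ a) ∧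
      ∀ γ γ', γ⁻¹ * γ' ∈ N → ∀ i j, dist (s γ i j) (s γ' i j) < ε := by
  obtain ⟨a, ha⟩ := exists_pow_lt_of_lt_one hε
    (inv_lt_one_of_one_lt₀ (Nat.one_lt_cast.2 (Fact.out : ℓ.Prime).one_lt) : (ℓ : ℝ)⁻¹ < 1)
  let φ : Matrix (Fin n) (Fin n) ℤ_[ℓ] →* Matrix (Fin n) (Fin n) (ZMod (ℓ ^ a)) :=
    MonoidHomClass.toMonoidHom (PadicInt.toZModPow a).mapMatrix
  have : NeZero (ℓ ^ a) := ⟨pow_ne_zero _ (Fact.out : ℓ.Prime).ne_zero⟩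
  refine ⟨(φ.comp s).toHomUnits.ker, inferInstance, exists_index_ker_eq_pow (φ.comp s)
    (fun γ i => ?_) (fun γ i j h => ?_) (Nat.card_zmod (ℓ ^ a)), fun γ γ' h i j => ?_⟩
  · exact (congrArg (PadicInt.toZModPow a) (h1 γ i)).trans (map_one _)
  · exact (congrArg (PadicInt.toZModPow a) (h0 γ i j h)).trans (map_zero _)
  · have h2 : (φ.comp s).toHomUnits γ = (φ.comp s).toHomUnits γ' := by
      rwa [MonoidHom.mem_ker, map_mul, map_inv, inv_mul_eq_one] at h
    have h3 : φ (s γ) = φ (s γ') := congrArg Units.val h2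
    have h4 : PadicInt.toZModPow a (s γ i j) = PadicInt.toZModPow a (s γ' i j) :=
      congrArg (fun M : Matrix (Fin n) (Fin n) (ZMod (ℓ ^ a)) => M i j) h3
    refine lt_of_le_of_lt ?_ ha
    rw [dist_eq_norm, inv_pow, ← zpow_natCast, ← zpow_neg,
      PadicInt.norm_le_pow_iff_mem_span_pow, ← PadicInt.ker_toZModPow, RingHom.mem_ker, map_sub,
      h4, sub_self]

/-- The integral form extends entry by entry; undoing the diagonal conjugation gives `R₀`. Its
algebraic identities hold on the image of `Γ` and pass to `P` by density. -/
theorem IsPrimePowerDense.exists_extension [Group.FG Γ] (hπ : IsPrimePowerDense ℓ π)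
    {r : Γ →* Matrix (Fin n) (Fin n) ℚ_[ℓ]} (hr : IsUnitriangularRep r) :
    ∃ R : P →* Matrix (Fin n) (Fin n) ℚ_[ℓ], IsUnitriangularRep R ∧
      (∀ i j, Continuous fun x => R x i j) ∧ ∀ γ, R (π γ) = r γ := by
  obtain ⟨c, s, h1, h0, hs⟩ := hr.exists_integral
  have hℓ : (ℓ : ℚ_[ℓ]) ≠ 0 := Nat.cast_ne_zero.2 (Fact.out : ℓ.Prime).ne_zero
  have hex : ∀ i j, ∃ g : P → ℤ_[ℓ], Continuous g ∧ ∀ γ, g (π γ) = s γ i j := by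
    refine fun i j => hπ.denseRange.exists_continuous_extension fun x ε hε => ?_
    obtain ⟨N, hN, hNa, hNε⟩ := exists_subgroup_dist_lt s h1 h0 hε
    obtain ⟨U, hU, h⟩ := hπ.exists_nhds N hN hNa x
    exact ⟨U, hU, fun γ γ' hγ hγ' => hNε γ γ' (h γ γ' hγ hγ') i j⟩
  choose g hg hgs using hex
  let R₀ : P → Matrix (Fin n) (Fin n) ℚ_[ℓ] := fun x => Matrix.of fun i j =>
    ((ℓ : ℚ_[ℓ]) ^ (c * j.val))⁻¹ * ((ℓ : ℚ_[ℓ]) ^ (c * i.val) * (g i j x : ℚ_[ℓ]))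
  have hRc : ∀ i j, Continuous fun x => R₀ x i j := fun i j =>
    continuous_const.mul (continuous_const.mul (continuous_subtype_val.comp (hg i j)))
  have hRr : ∀ γ, R₀ (π γ) = r γ := by
    intro γ
    ext i j
    change ((ℓ : ℚ_[ℓ]) ^ (c * j.val))⁻¹ *
      ((ℓ : ℚ_[ℓ]) ^ (c * i.val) * (g i j (π γ) : ℚ_[ℓ])) = r γ i j
    rw [hgs, hs, inv_mul_cancel_left₀ (pow_ne_zero _ hℓ)]
  have hdense : ∀ {f f' : P → ℚ_[ℓ]}, Continuous f → Continuous f' →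
      (∀ γ, f (π γ) = f' (π γ)) → ∀ x, f x = f' x := fun hf hf' h =>
    congrFun (hπ.denseRange.equalizer hf hf' (funext h))
  refine ⟨⟨⟨R₀, ?_⟩, fun x y => ?_⟩, fun x => ⟨fun i => ?_, fun i j h => ?_⟩, hRc, hRr⟩
  · rw [← map_one π, hRr, map_one]
  · have hcm : ∀ i j, ∀ f f' : P → P, Continuous f → Continuous f' →
        Continuous fun x => (R₀ (f x) * R₀ (f' x)) i j := by
      intro i j f f' hf hf'
      simp only [Matrix.mul_apply]
      exact continuous_finsetSum _ fun l _ => ((hRc i l).comp hf).mul ((hRc l j).comp hf')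
    -- Density is applied to one factor at a time, the other being held fixed.
    have hγ : ∀ γ y, R₀ (π γ * y) = R₀ (π γ) * R₀ y := by
      intro γ y
      ext i j
      refine hdense ((hRc i j).comp (continuous_const.mul continuous_id))
        (hcm i j _ _ continuous_const continuous_id) (fun γ' => ?_) y
      change R₀ (π γ * π γ') i j = (R₀ (π γ) * R₀ (π γ')) i j
      rw [← map_mul, hRr, hRr, hRr, map_mul]
    ext i j
    refine hdense ((hRc i j).comp (continuous_id.mul continuous_const))
      (hcm i j _ _ continuous_id continuous_const) (fun γ => ?_) x
    exact congrFun (congrFun (hγ γ y) i) j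
  · refine hdense (hRc i i) continuous_const (fun γ => ?_) x
    rw [hRr, (hr γ).1]
  · refine hdense (hRc i j) continuous_const (fun γ => ?_) x
    rw [hRr, (hr γ).2 i j h]

/-- Regular functions are continuous on `P`, so one vanishing on the dense image of `Γ` vanishes on
`P`; coefficients on `Γ` come from extended representations. -/
theorem IsPrimePowerDense.isUnipotentHull [Group.FG Γ] [TopologicalSpace Γ] [DiscreteTopology Γ]
    (hπ : IsPrimePowerDense ℓ π) {B : Type*} [CommRing B] [HopfAlgebra ℚ_[ℓ] B]
    {θ : P →* RationalPoints ℚ_[ℓ] B} (hθ : IsUnipotentHull θ) : IsUnipotentHull (θ.comp π) where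
  prounipotent := hθ.prounipotent
  continuous _ := continuous_of_discreteTopology
  separating b hb := hθ.separating b <| congrFun <|
    hπ.denseRange.equalizer (hθ.continuous b) continuous_const (funext hb)
  coeff_mem n r hr _ i j := by
    obtain ⟨R, hR, hRc, hRr⟩ := hπ.exists_extension hr
    obtain ⟨b, hb⟩ := hθ.coeff_mem n R hR hRc i j
    exact ⟨b, funext fun γ => (congrFun hb (π γ)).trans (by rw [hRr])⟩

end Extension

/-! ### The pro-`ℓ` and the profinite completion -/

section Completions

open Filter Topology

variable (ℓ : ℕ) (Γ : Type u) [Group Γ]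

variable {ℓ Γ} in
theorem ProLCompletion.isOpen_preimage (N : PrimePowerIndexNormalSubgroup ℓ Γ)
    (s : Set (Γ ⧸ N.1)) : IsOpen {x : ProLCompletion ℓ Γ | x.1 N ∈ s} := by
  have h : (⨅ N : PrimePowerIndexNormalSubgroup ℓ Γ,
      TopologicalSpace.induced (fun x : ProLCompletion ℓ Γ => x.1 N) ⊥) ≤ _ := iInf_le _ N
  exact h _ ⟨s, trivial, rfl⟩

variable {ℓ Γ} in
theorem ProLCompletion.continuous_iff {X : Type*} [TopologicalSpace X]
    {f : X → ProLCompletion ℓ Γ} :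
    Continuous f ↔ ∀ N q, IsOpen {x | (f x).1 N = q} := by
  refine ⟨fun h N q => (isOpen_preimage N {q}).preimage h, fun h => ?_⟩
  refine continuous_iInf_rng.2 fun N => continuous_induced_rng.2 ?_
  let _ : TopologicalSpace (Γ ⧸ N.1) := ⊥
  have : DiscreteTopology (Γ ⧸ N.1) := ⟨rfl⟩
  exact continuous_discrete_rng.2 fun q => h N q

instance : ContinuousMul (ProLCompletion ℓ Γ) where
  continuous_mul := by
    refine ProLCompletion.continuous_iff.2 fun N q => ?_
    have : {p : ProLCompletion ℓ Γ × ProLCompletion ℓ Γ | (p.1 * p.2).1 N = q} =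
        ⋃ r : Γ ⧸ N.1, {x | x.1 N ∈ ({r} : Set (Γ ⧸ N.1))} ×ˢ
          {x | x.1 N ∈ ({r⁻¹ * q} : Set (Γ ⧸ N.1))} := by
      ext p
      change p.1.1 N * p.2.1 N = q ↔ _
      simp [eq_inv_mul_iff_mul_eq]
    rw [this]
    exact isOpen_iUnion fun r =>
      (ProLCompletion.isOpen_preimage N _).prod (ProLCompletion.isOpen_preimage N _)

variable [Fact ℓ.Prime]

variable {ℓ Γ} in
theorem PrimePowerIndexNormalSubgroup.exists_le (N₁ N₂ : PrimePowerIndexNormalSubgroup ℓ Γ) :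
    ∃ N : PrimePowerIndexNormalSubgroup ℓ Γ, N.1 ≤ N₁.1 ∧ N.1 ≤ N₂.1 := by
  obtain ⟨a, ha⟩ := N₁.2.2
  obtain ⟨b, hb⟩ := N₂.2.2
  have h : N₁.1.relIndex N₂.1 ∣ ℓ ^ a := ha ▸ Subgroup.relIndex_dvd_index_of_normal N₁.1 N₂.1
  obtain ⟨c, -, hc⟩ := (Nat.dvd_prime_pow Fact.out).1 h
  refine ⟨⟨N₁.1 ⊓ N₂.1, inferInstance, c + b, ?_⟩, inf_le_left, inf_le_right⟩
  rw [← Subgroup.relIndex_mul_index inf_le_right, Subgroup.inf_relIndex_right, hc, hb, pow_add]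

/-- Normal subgroups of `ℓ`-power index are stable under intersection, so the fibres of single
projections, not just their finite intersections, form a neighbourhood basis. -/
theorem ProLCompletion.exists_subset_of_mem_nhds {x : ProLCompletion ℓ Γ}
    {U : Set (ProLCompletion ℓ Γ)} (hU : U ∈ 𝓝 x) :
    ∃ N : PrimePowerIndexNormalSubgroup ℓ Γ, {y | y.1 N = x.1 N} ⊆ U := by
  have : Nonempty (PrimePowerIndexNormalSubgroup ℓ Γ) := ⟨⟨⊤, inferInstance, 0, by simp⟩⟩
  have h : 𝓝 x = ⨅ N : PrimePowerIndexNormalSubgroup ℓ Γ,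
      𝓟 {y : ProLCompletion ℓ Γ | y.1 N = x.1 N} := by
    refine (nhds_iInf (a := x)).trans (iInf_congr fun N => ?_)
    let _ : TopologicalSpace (Γ ⧸ N.1) := ⊥
    have : DiscreteTopology (Γ ⧸ N.1) := ⟨rfl⟩
    refine (nhds_induced _ x).trans ?_
    rw [nhds_discrete, comap_pure]
    rfl
  rw [h, mem_iInf_of_directed] at hU
  · obtain ⟨N, hN⟩ := hU
    exact ⟨N, mem_principal.1 hN⟩
  · intro N₁ N₂
    obtain ⟨N, h₁, h₂⟩ := N₁.exists_le N₂
    have hle : ∀ M : PrimePowerIndexNormalSubgroup ℓ Γ, N.1 ≤ M.1 →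
        𝓟 {y : ProLCompletion ℓ Γ | y.1 N = x.1 N} ≤ 𝓟 {y | y.1 M = x.1 M} := by
      intro M hM
      refine principal_mono.2 fun y (hy : y.1 N = x.1 N) => ?_
      change y.1 M = x.1 M
      rw [← y.2 N M hM, ← x.2 N M hM, hy]
    exact ⟨N, hle _ h₁, hle _ h₂⟩

theorem ProLCompletion.denseRange_ofGroup : DenseRange (ProLCompletion.ofGroup ℓ Γ) := by
  refine fun x => mem_closure_iff_nhds.2 fun U hU => ?_
  obtain ⟨N, hN⟩ := exists_subset_of_mem_nhds ℓ Γ hU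
  obtain ⟨γ, hγ⟩ := QuotientGroup.mk_surjective (x.1 N)
  exact ⟨_, hN hγ, γ, rfl⟩

theorem ProLCompletion.isPrimePowerDense_ofGroup :
    IsPrimePowerDense ℓ (ProLCompletion.ofGroup ℓ Γ) where
  denseRange := denseRange_ofGroup ℓ Γ
  exists_nhds N hN ha x := by
    let N' : PrimePowerIndexNormalSubgroup ℓ Γ := ⟨N, hN, ha⟩
    refine ⟨{y | y.1 N' = x.1 N'}, (isOpen_preimage N' {x.1 N'}).mem_nhds rfl, fun γ γ' h h' => ?_⟩
    exact QuotientGroup.eq.1 (show ((γ : Γ ⧸ N) = γ') from h.trans h'.symm)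

theorem isOpen_profinite_fiber (N : FiniteIndexNormalSubgroup (GrpCat.of Γ))
    (q : Γ ⧸ N.toSubgroup) : IsOpen {x : ProfiniteCompletion Γ | x.1 N = q} := by
  have h : Continuous fun x : ProfiniteCompletion Γ => x.1 N :=
    (continuous_apply N).comp continuous_subtype_val
  have : DiscreteTopology ((ProfiniteGrp.ProfiniteCompletion.diagram (GrpCat.of Γ)).obj N) := ⟨rfl⟩
  exact (isOpen_discrete ({q} : Set ((ProfiniteGrp.ProfiniteCompletion.diagram
    (GrpCat.of Γ)).obj N))).preimage h

theorem isPrimePowerDense_toProfiniteCompletion :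
    IsPrimePowerDense ℓ (toProfiniteCompletion Γ) where
  denseRange := ProfiniteGrp.ProfiniteCompletion.denseRange (GrpCat.of Γ)
  exists_nhds N hN ha x := by
    let N' := PrimePowerIndexNormalSubgroup.toFiniteIndex (ℓ := ℓ) ⟨N, hN, ha⟩
    refine ⟨{y | y.1 N' = x.1 N'}, (isOpen_profinite_fiber Γ N' (x.1 N')).mem_nhds rfl,
      fun γ γ' h h' => ?_⟩
    exact QuotientGroup.eq.1 (show ((γ : Γ ⧸ N) = γ') from h.trans h'.symm)

theorem continuous_profiniteToProL : Continuous (profiniteToProL ℓ Γ) :=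
  ProLCompletion.continuous_iff.2 fun N q => isOpen_profinite_fiber Γ N.toFiniteIndex q

end Completions

end

theorem mainTheorem11 {Γ : Type u} [Group Γ] [Group.FG Γ] (ℓ : ℕ) [Fact ℓ.Prime] :
    (∃ (A : Type u) (_ : CommRing A) (_ : HopfAlgebra ℚ A) (θ : Γ →* RationalPoints ℚ A),
      IsUnipotentCompletion θ) ∧
    (∃ (B : Type u) (_ : CommRing B) (_ : HopfAlgebra ℚ_[ℓ] B)
      (θ : ProLCompletion ℓ Γ →* RationalPoints ℚ_[ℓ] B), IsContinuousUnipotentCompletion θ) ∧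
    (∃ (C : Type u) (_ : CommRing C) (_ : HopfAlgebra ℚ_[ℓ] C)
      (θ : ProfiniteCompletion Γ →* RationalPoints ℚ_[ℓ] C),
      IsContinuousUnipotentCompletion θ) ∧
    ∀ (A : Type v) [CommRing A] [HopfAlgebra ℚ A] (θ : Γ →* RationalPoints ℚ A)
      (B : Type w) [CommRing B] [HopfAlgebra ℚ_[ℓ] B]
      (θB : ProLCompletion ℓ Γ →* RationalPoints ℚ_[ℓ] B)
      (C : Type w') [CommRing C] [HopfAlgebra ℚ_[ℓ] C]
      (θC : ProfiniteCompletion Γ →* RationalPoints ℚ_[ℓ] C),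
      IsUnipotentCompletion θ → IsContinuousUnipotentCompletion θB →
      IsContinuousUnipotentCompletion θC →
      (∃! φ : B ≃ₐc[ℚ_[ℓ]] (ℚ_[ℓ] ⊗[ℚ] A), ∀ (γ : Γ) (b : B),
        (extendPoint ℚ_[ℓ] (θ γ)).ofConv (φ b) =
          (θB (ProLCompletion.ofGroup ℓ Γ γ)).ofConv b) ∧
      (∃! φ : C ≃ₐc[ℚ_[ℓ]] (ℚ_[ℓ] ⊗[ℚ] A), ∀ (γ : Γ) (c : C),
        (extendPoint ℚ_[ℓ] (θ γ)).ofConv (φ c) =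
          (θC (toProfiniteCompletion Γ γ)).ofConv c) ∧
      (∃! φ : B ≃ₐc[ℚ_[ℓ]] C, ∀ (x : ProfiniteCompletion Γ) (b : B),
        (θC x).ofConv (φ b) = (θB (profiniteToProL ℓ Γ x)).ofConv b) := by
  -- With `Γ` discrete, continuity is vacuous and the abstract completion becomes a continuous one.
  let _ : TopologicalSpace Γ := ⊥
  have : DiscreteTopology Γ := ⟨rfl⟩
  refine ⟨⟨unipotentFunctions ℚ Γ, inferInstance, inferInstance, _, isUnipotentCompletion_iff.2
      (isUnipotentHull_points ℚ Γ).isContinuousUnipotentCompletion⟩,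
    ⟨unipotentFunctions ℚ_[ℓ] (ProLCompletion ℓ Γ), inferInstance, inferInstance, _,
      (isUnipotentHull_points _ _).isContinuousUnipotentCompletion⟩,
    ⟨unipotentFunctions ℚ_[ℓ] (ProfiniteCompletion Γ), inferInstance, inferInstance, _,
      (isUnipotentHull_points _ _).isContinuousUnipotentCompletion⟩, ?_⟩
  intro A _ _ θ B _ _ θB C _ _ θC hθ hθB hθC
  have hA := (isUnipotentCompletion_iff.1 hθ).isUnipotentHull.baseChange ℚ_[ℓ]
  have hB := (ProLCompletion.isPrimePowerDense_ofGroup ℓ Γ).isUnipotentHull hθB.isUnipotentHull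
  have hdense := isPrimePowerDense_toProfiniteCompletion ℓ Γ
  have hC := hdense.isUnipotentHull hθC.isUnipotentHull
  refine ⟨hA.existsUnique_bialgEquiv hB, hA.existsUnique_bialgEquiv hC, ?_⟩
  -- Obtained over `Γ`, the isomorphism is compatible on the whole profinite completion because both
  -- sides are continuous and `Γ` is dense. Uniqueness needs only the restriction to `Γ`, whose
  -- composite map to the pro-`ℓ` completion is `ProLCompletion.ofGroup`.
  obtain ⟨φ, hφ, huniq⟩ := hC.existsUnique_bialgEquiv hB
  refine ⟨φ, fun x b => ?_, fun ψ hψ => huniq ψ fun γ b => hψ (toProfiniteCompletion Γ γ) b⟩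
  exact congrFun (hdense.denseRange.equalizer (hθC.continuous (φ b))
    ((hθB.continuous b).comp (continuous_profiniteToProL ℓ Γ)) (funext fun γ => hφ γ b)) x
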